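/- Let $\mathbb{D}$ be a division ring, let $\mathbb{F}$ be a subfield of the center of $\mathbb{D}$, and assume that $d:=\dim_{\mathbb{F}}\mathbb{D}$ is finite. Let $V$ be a right $\mathbb{D}$-vector space of finite dimension $n>0$, and assume that $|\mathbb{F}|\ge nd$. Let $b:V\times V\to\mathbb{F}$ be an $\mathbb{F}$-bilinear form that is nonisotropic, i.e. $b(x,x)\neq 0$ for all $x\in V\setminus\{0\}$. Set $$\mathcal{A}_{b,\mathbb{D}}:=\{u\in\operatorname{End}_{\mathbb{D}}(V) : \forall x\in V,\ b(x,u(x))=0\}.$$ **Definitions.** An $\mathbb{F}$-linear subspace $\mathcal{S}$ of $\operatorname{End}_{\mathbb{D}}(V)$ has *$\mathbb{F}$-trivial spectrum* if no element of $\mathcal{S}$ has a nonzero eigenvalue in $\mathbb{F}$; it is then *optimal* if its dimension over $\mathbb{F}$ is the greatest possible among the $\mathbb{F}$-trivial spectrum linear subspaces of $\operatorname{End}_{\mathbb{D}}(V)$. It is *irreducible* if $V\neq\{0\}$ and the only $\mathbb{D}$-linear subspaces of $V$ invariant under all elements of $\mathcal{S}$ are $\{0\}$ and $V$. $\mathbb{D}$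 is *of quadratic type* over $\mathbb{F}$ if one of the following holds: (1) $d=1$; (2) $d=2$ and $\mathbb{D}$ is a separable extension of $\mathbb{F}$; (3) $d=4$ and $\mathbb{D}$ is a quaternion algebra over $\mathbb{F}$; (4) $\operatorname{char}\mathbb{F}=2$, $d=2^m$ for some $m\ge 1$, $\mathbb{D}$ is commutative and $x^2\in\mathbb{F}$ for all $x\in\mathbb{D}$. The *standard involution* $\sigma$ of $\mathbb{D}$ is then the identity in cases (1) and (4), the nonidentity $\mathbb{F}$-automorphism in case (2), and the quaternionic conjugation in case (3). A pair $(\sigma,e)$ is an *associated pair* for $\mathbb{D}$ over $\mathbb{F}$ if $\mathbb{D}$ is of quadratic type over $\mathbb{F}$, $\sigma$ is its standard involution, and $e:\mathbb{D}\to\mathbb{F}$ is the trace of $\mathbb{D}$ over $\mathbb{F}$ in cases (1) and (2), the reduced trace $x\mapsto x+\sigma(x)$ in case (3), and an arbitrary nonzero $\mathbb{F}$-linear form on $\mathbb{D}$ in case (4). A *$\sigma$-sesquilinear form* on $V$ is a biadditive map $B:V\times V\to\mathbb{D}$ such that $B(x\alpha,y)=\sigma(\alpha)B(x,y)$ and $B(x,y\alpha)=B(x,y)\alpha$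 for all $x,y\in V$ and $\alpha\in\mathbb{D}$. **Theorem.** The space $\mathcal{A}_{b,\mathbb{D}}$ is an irreducible optimal $\mathbb{F}$-trivial spectrum subspace of $\operatorname{End}_{\mathbb{D}}(V)$ if and only if both of the following conditions hold: (i) $\mathbb{D}$ is of quadratic type over $\mathbb{F}$; (ii) for every associated pair $(\sigma,e)$ for $\mathbb{D}$ over $\mathbb{F}$, there is a $\sigma$-sesquilinear form $B$ on $V$ such that $b(x,y)=e(B(x,y))$ for all $x,y\in V$. Moreover, whenever $(\sigma,e)$ is a given associated pair for $\mathbb{D}$ over $\mathbb{F}$, the space $\mathcal{A}_{b,\mathbb{D}}$ is an irreducible optimal $\mathbb{F}$-trivial spectrum subspace if and only if such a form $B$ exists for that pair. For each associated pair $(\sigma,e)$, a $\sigma$-sesquilinear form $B$ such that $b(x,y)=e(B(x,y))$ for all $x,y\in V$ is uniquely determined by $b$. -/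

import Mathlib

open scoped Quaternion MulOpposite

namespace TrivialSpectrum

noncomputable section

/-! ### Division algebras of quadratic type

`D` is a division ring that is finite-dimensional over a field `F` contained in its centre
(expressed by `[Algebra F D]`). -/

section DivisionAlgebra

variable (F D : Type*) [Field F] [DivisionRing D] [Algebra F D]

/-- `D` is a separable extension of `F` of degree `2` (a division ring of degree `2` over `F` is
automatically commutative). -/
def IsSeparableQuadratic : Prop :=
  Module.finrank F D = 2 ∧ Algebra.IsSeparable F D

variable {F D} in
/-- `φ` is an isomorphism of `D` with the quaternion algebra over `F` that has a basis
`1, i, j, ij` with `i ^ 2 = a + b i`, `j ^ 2 = c` and `j i = (b - i) j`. The conditions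
`b ^ 2 + 4 a ≠ 0` (i.e. `t ^ 2 - b t - a` is separable) and `c ≠ 0` make this the standard notion of
a quaternion algebra in every characteristic, including `2`. -/
def IsQuaternionPresentation {a b c : F} (_φ : D ≃ₐ[F] ℍ[F,a,b,c]) : Prop :=
  b ^ 2 + 4 * a ≠ 0 ∧ c ≠ 0

/-- `D` is a quaternion algebra over `F`. -/
def IsQuaternionAlgebra : Prop :=
  ∃ (a b c : F) (φ : D ≃ₐ[F] ℍ[F,a,b,c]), IsQuaternionPresentation φ

/-- `F` has characteristic `2`, the degree of `D` over `F` is `2 ^ m` with `m ≥ 1`, and `D` is a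
hyper-radicial extension of `F`: it is commutative and all its elements have their square in `F`. -/
def IsHyperRadicial : Prop :=
  CharP F 2 ∧ (∃ m : ℕ, 1 ≤ m ∧ Module.finrank F D = 2 ^ m) ∧
    (∀ x y : D, x * y = y * x) ∧ ∀ x : D, ∃ c : F, x ^ 2 = algebraMap F D c

/-- `D` is of quadratic type over `F`. -/
def IsQuadraticType : Prop :=
  Module.finrank F D = 1 ∨
  IsSeparableQuadratic F D ∨
  (Module.finrank F D = 4 ∧ IsQuaternionAlgebra F D) ∨
  IsHyperRadicial F D

/-- `σ` is the standard involution of the algebra `D` of quadratic type over `F`: the identity if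
`D = F` or `D` is hyper-radicial, the nonidentity automorphism if `D` is a separable quadratic
extension, the quaternionic conjugation if `D` is a quaternion algebra. -/
def IsStandardInvolution (σ : D → D) : Prop :=
  (Module.finrank F D = 1 ∧ σ = id) ∨
  (IsSeparableQuadratic F D ∧ ∃ τ : D ≃ₐ[F] D, τ ≠ AlgEquiv.refl ∧ σ = τ) ∨
  (Module.finrank F D = 4 ∧ ∃ (a b c : F) (φ : D ≃ₐ[F] ℍ[F,a,b,c]),
    IsQuaternionPresentation φ ∧ ∀ x : D, φ (σ x) = star (φ x)) ∨
  (IsHyperRadicial F D ∧ σ = id)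

/-- The trace of `D` over `F`: it maps `a` to the trace of the `F`-endomorphism `x ↦ a * x`. -/
def regularTrace : D →ₗ[F] F :=
  LinearMap.trace F D ∘ₗ LinearMap.mul F D

/-- `(σ, e)` is an associated pair for `D` over `F`: `D` is of quadratic type, `σ` is its standard
involution, and the linear form `e` is the trace if `D` has degree `1` or is a separable quadratic
extension, the reduced trace `x ↦ x + σ x` if `D` is a quaternion algebra, and an arbitrary nonzero
linear form if `D` is hyper-radicial. -/
def IsAssociatedPair (σ : D → D) (e : D →ₗ[F] F) : Prop :=
  IsQuadraticType F D ∧ IsStandardInvolution F D σ ∧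
  (Module.finrank F D = 1 → e = regularTrace F D) ∧
  (IsSeparableQuadratic F D → e = regularTrace F D) ∧
  (Module.finrank F D = 4 ∧ IsQuaternionAlgebra F D →
    ∀ x : D, algebraMap F D (e x) = x + σ x) ∧
  (IsHyperRadicial F D → e ≠ 0)

end DivisionAlgebra

/-! ### Spaces of endomorphisms and forms

A right vector space over `D` is a module over `Dᵐᵒᵖ`, the vector `x α` being `op α • x`. -/

section Forms

variable {F D V : Type*} [Field F] [DivisionRing D] [Algebra F D]
  [AddCommGroup V] [Module F V] [Module Dᵐᵒᵖ V] [IsScalarTower F Dᵐᵒᵖ V]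

/-- The bilinear form `b` is nonisotropic: `b x x ≠ 0` for all nonzero `x`. -/
def IsNonisotropic (b : LinearMap.BilinForm F V) : Prop :=
  ∀ x : V, x ≠ 0 → b x x ≠ 0

variable (D) in
/-- The `F`-linear space `𝒜_{b,D}` of all `D`-linear endomorphisms `u` of `V` that are
`b`-alternating, i.e. `b x (u x) = 0` for all `x`. -/
def alternatingEnd (b : LinearMap.BilinForm F V) : Submodule F (Module.End Dᵐᵒᵖ V) where
  carrier := {u | ∀ x : V, b x (u x) = 0}
  add_mem' := by
    intro u v hu hv x
    simp [hu x, hv x]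
  zero_mem' := by
    intro x
    simp
  smul_mem' := by
    intro c u hu x
    simp [hu x]

/-- `S` has `F`-trivial spectrum: no element of `S` has a nonzero eigenvalue in `F`. -/
def HasTrivialSpectrum (S : Submodule F (Module.End Dᵐᵒᵖ V)) : Prop :=
  ∀ u ∈ S, ∀ c : F, c ≠ 0 → ∀ x : V, u x = c • x → x = 0

/-- `S` is an optimal `F`-trivial spectrum subspace of `End_D(V)`: it has the greatest dimension
over `F` among the `F`-linear subspaces with `F`-trivial spectrum. -/
def IsOptimal (S : Submodule F (Module.End Dᵐᵒᵖ V)) : Prop :=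
  HasTrivialSpectrum S ∧
    ∀ T : Submodule F (Module.End Dᵐᵒᵖ V), HasTrivialSpectrum T →
      Module.finrank F T ≤ Module.finrank F S

/-- `S` is irreducible: `V` is nonzero and has no nontrivial `D`-linear subspace that is invariant
under all the elements of `S`. -/
def IsIrreducible (S : Submodule F (Module.End Dᵐᵒᵖ V)) : Prop :=
  Nontrivial V ∧
    ∀ W : Submodule Dᵐᵒᵖ V, (∀ u ∈ S, ∀ x ∈ W, u x ∈ W) → W = ⊥ ∨ W = ⊤

/-- `B` is a `σ`-sesquilinear form on the right `D`-vector space `V`: it is biadditive, with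
`B(x α, y) = σ(α) B(x, y)` and `B(x, y α) = B(x, y) α`. -/
structure IsSesquilinear (σ : D → D) (B : V → V → D) : Prop where
  add_left : ∀ x x' y : V, B (x + x') y = B x y + B x' y
  smul_left : ∀ (α : D) (x y : V), B (MulOpposite.op α • x) y = σ α * B x y
  add_right : ∀ x y y' : V, B x (y + y') = B x y + B x y'
  smul_right : ∀ (α : D) (x y : V), B x (MulOpposite.op α • y) = B x y * α

end Forms

end

end TrivialSpectrum

/-! Put d = dim_F D. The governing number is d·C(n+1,2) − n, the greatest dimension of a space with
trivial spectrum. For the upper bound, some line receives the whole range of at most d − 1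
independent operators of the space (`exists_finrank_endsInto_lt`, where #F ≥ nd serves to increase
ranks); factoring this line out gives an induction on n (`finrank_add_le_of_trivialSpectrum`).
Triangular matrices with diagonal entries in a hyperplane of D that avoids 1 attain the bound.

The same count on a quotient shows that an optimal 𝒜_b maps each x ≠ 0 onto all y with b(x,y) = 0
(`IsOptimal.exists_apply_eq`); irreducibility follows. As the operators are D-linear, b(x,y) = 0
then implies b(xα,yα) = 0, so b(xα,yα) = q(α) b(x,y), and right multiplication by α has adjoint σ(α)
= q(α)α⁻¹ (`exists_isNormInvolution`). This σ is an antiautomorphism with σ(α)α in F: every element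
of D is quadratic over F, which makes σ unique and D of quadratic type. Writing b(x,yα) = e(B(x,y)α)
yields B.

Conversely, given B, 𝒜_b contains the solutions of n scalar and C(n,2) D-valued linear equations, so
it reaches the bound (`IsTracePair.le_finrank_alternatingEnd`). -/

namespace TrivialSpectrum

open Module LinearMap

/-! ### Raising the rank in a linear space of operators. -/

section LinearAlgebra

variable {F U U' : Type*} [Field F] [AddCommGroup U] [Module F U] [AddCommGroup U'] [Module F U']
  [FiniteDimensional F U']

/-- If an endomorphism acts on a space of dimension less than `#F`, then some scalar of `F` is not
an eigenvalue of it. -/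
theorem exists_not_hasEigenvalue (f : Module.End F U')
    (h : (finrank F U' : Cardinal) < Cardinal.mk F) :
    ∃ s : F, ¬ f.HasEigenvalue s := by
  obtain ⟨s, hs⟩ := f.charpoly.exists_eval_ne_zero_of_natDegree_lt_card
    f.charpoly_monic.ne_zero (by rwa [LinearMap.charpoly_natDegree])
  exact ⟨s, fun h => hs ((Module.End.hasEigenvalue_iff_isRoot_charpoly f s).1 h)⟩

/-- In a linear space of operators over a large field, an operator of maximal rank maps to its range
no vector of its kernel that another operator takes outside this range. -/
theorem exists_finrank_range_lt (a b : U →ₗ[F] U')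
    (h : (finrank F (range a) : Cardinal) < Cardinal.mk F) {x : U} (hx : a x = 0)
    (hbx : b x ∉ range a) :
    ∃ s : F, finrank F (range a) < finrank F (range (s • a + b)) := by
  obtain ⟨r, hr⟩ := a.rangeRestrict.exists_rightInverse_of_surjective a.range_rangeRestrict
  have hdisj : Disjoint (range a) (F ∙ b x) := by
    rw [Submodule.disjoint_span_singleton]
    exact fun h => absurd h hbx
  -- The complement contains `b x`, so that the projection `g` along it kills `b x`.
  obtain ⟨C, hC, hcompl⟩ := hdisj.symm.exists_isCompl
  obtain ⟨g, hg, hgb⟩ : ∃ g : U' →ₗ[F] range a, (∀ y : range a, g y = y) ∧ g (b x) = 0 := by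
    refine ⟨(range a).projectionOnto C hcompl.symm, fun y => by simp, ?_⟩
    · rw [Submodule.projectionOnto_apply_eq_zero_iff]
      exact hC (Submodule.mem_span_singleton_self _)
  obtain ⟨s, hs⟩ := exists_not_hasEigenvalue (-(g ∘ₗ b ∘ₗ r)) h
  refine ⟨s, ?_⟩
  set f := s • a + b with hf
  -- On `range a` this map is `s • id + g ∘ b ∘ r`, injective since `s` is not an eigenvalue of `-(g
  -- ∘ b ∘ r)`.
  have hinj : Function.Injective (g ∘ₗ f ∘ₗ r) := by
    rw [injective_iff_map_eq_zero]
    intro y hy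
    by_contra hy0
    refine hs (Module.End.hasEigenvalue_of_hasEigenvector (x := y) ⟨?_, hy0⟩)
    rw [Module.End.mem_eigenspace_iff]
    have h1 : g (a (r y)) = y := by
      have := congrArg (fun k => k y) hr
      simp only [comp_apply, id_apply] at this
      have h2 : a (r y) = y := congrArg Subtype.val this
      rw [h2, hg]
    simp only [hf, comp_apply, LinearMap.add_apply, LinearMap.smul_apply, map_add, map_smul, h1] at hy
    simp only [LinearMap.neg_apply, comp_apply]
    exact (eq_neg_of_add_eq_zero_left hy).symm
  have hsurj := LinearMap.surjective_of_injective hinj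
  set g' := g.domRestrict (range f)
  have hg' : Function.Surjective g' := fun y => by
    obtain ⟨z, hz⟩ := hsurj y
    exact ⟨⟨f (r z), mem_range_self _ _⟩, hz⟩
  -- `f x = b x` is a nonzero vector of `range f` killed by `g`.
  have hker : ker g' ≠ ⊥ := by
    intro hbot
    have hm : (⟨b x, x, by simp [hf, hx]⟩ : range f) ∈ ker g' := hgb
    rw [hbot, Submodule.mem_bot] at hm
    have h0 : b x = 0 := congrArg Subtype.val hm
    exact hbx (h0 ▸ zero_mem _)
  have h1 := g'.finrank_range_add_finrank_ker
  rw [LinearMap.range_eq_top.2 hg', finrank_top] at h1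
  have h2 : 0 < finrank F (ker g') := by
    rw [Nat.pos_iff_ne_zero]
    exact fun h0 => hker (Submodule.finrank_eq_zero.1 h0)
  omega

end LinearAlgebra

/-! ### Upper bound for the dimension of a trivial spectrum space. -/

section UpperBound

variable {F R V : Type*} [Field F] [DivisionRing R] [Algebra F R] [FiniteDimensional F R]
  [AddCommGroup V] [Module F V] [Module R V] [IsScalarTower F R V] [FiniteDimensional R V]

theorem finrank_end [FiniteDimensional F V] :
    finrank F (Module.End R V) = finrank R V * (finrank R V * finrank F R) := by
  rw [← ((finBasis R V).constr F (M' := V)).finrank_eq, finrank_pi_fintype, Finset.sum_const,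
    Finset.card_univ, Fintype.card_fin, smul_eq_mul, ← finrank_mul_finrank F R V,
    Nat.mul_comm (finrank F R)]

omit [FiniteDimensional F R] in
theorem finiteDimensional_end [FiniteDimensional F V] : FiniteDimensional F (Module.End R V) :=
  Module.Finite.equiv ((finBasis R V).constr F (M' := V))

omit [FiniteDimensional F R] [FiniteDimensional R V]

/-- The elements of `S` with range included in the line spanned by `x`. -/
def endsInto (S : Submodule F (Module.End R V)) (x : V) : Submodule F (Module.End R V) where
  carrier := {u | u ∈ S ∧ ∀ y, u y ∈ R ∙ x}
  add_mem' hu hv := ⟨add_mem hu.1 hv.1, fun y => add_mem (hu.2 y) (hv.2 y)⟩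
  zero_mem' := ⟨zero_mem _, fun _ => zero_mem _⟩
  smul_mem' c _ hu := ⟨S.smul_mem c hu.1, fun y => Submodule.smul_of_tower_mem _ c (hu.2 y)⟩

/-- The elements of `S` that leave the line spanned by `x` invariant. -/
def endsStabilizing (S : Submodule F (Module.End R V)) (x : V) : Submodule F (Module.End R V) where
  carrier := {u | u ∈ S ∧ u x ∈ R ∙ x}
  add_mem' hu hv := ⟨add_mem hu.1 hv.1, add_mem hu.2 hv.2⟩
  zero_mem' := ⟨zero_mem _, zero_mem _⟩
  smul_mem' c _ hu := ⟨S.smul_mem c hu.1, Submodule.smul_of_tower_mem _ c hu.2⟩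

/-- Some line is the target of few elements of a space with trivial spectrum. -/
theorem exists_finrank_endsInto_lt [FiniteDimensional F R] [FiniteDimensional R V]
    [FiniteDimensional F V] (hn : 0 < finrank R V)
    (hF : ((finrank R V * finrank F R : ℕ) : Cardinal) ≤ Cardinal.mk F)
    (S : Submodule F (Module.End R V))
    (hS : ∀ u ∈ S, ∀ c : F, c ≠ 0 → ∀ x : V, u x = c • x → x = 0) :
    ∃ x : V, x ≠ 0 ∧ finrank F (endsInto S x) < finrank F R := by
  have := finiteDimensional_end (F := F) (R := R) (V := V)
  by_contra! hcon
  set β := finBasis R V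
  let c (i : Fin (finrank R V)) (y : V) : endsInto S (β i) →ₗ[F] R :=
    { toFun := fun u => β.coord i (u.1 y)
      map_add' := fun u v => by simp
      map_smul' := fun a u => LinearMap.map_smul_of_tower (β.coord i) a (u.1 y) }
  have hc (i) (u : endsInto S (β i)) (y : V) : u.1 y = c i y u • β i := by
    obtain ⟨r, hr⟩ := Submodule.mem_span_singleton.1 (u.2.2 y)
    change u.1 y = β.coord i (u.1 y) • β i
    rw [← hr]; simp
  let ev (y : V) : (∀ i, endsInto S (β i)) →ₗ[F] (Fin (finrank R V) → R) :=
    LinearMap.pi fun i => c i y ∘ₗ LinearMap.proj i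
  have hev (s : F) (y z : V) : s • ev y + ev z = ev (s • y + z) := by
    refine LinearMap.ext fun v => funext fun i => ?_
    change s • β.coord i ((v i).1 y) + β.coord i ((v i).1 z) = β.coord i ((v i).1 (s • y + z))
    rw [map_add, map_add, LinearMap.map_smul_of_tower, LinearMap.map_smul_of_tower]
  -- The values of `ev` form a linear space of operators; one of maximal rank is found by minimising
  -- the corank.
  obtain ⟨y, hy⟩ : ∃ y, ∀ z, finrank F (range (ev z)) ≤ finrank F (range (ev y)) := by
    let N := finrank F (Fin (finrank R V) → R)
    let f (y : V) := N - finrank F (range (ev y))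
    refine ⟨Function.argmin f, fun z => ?_⟩
    have h1 := Function.argmin_le f z
    have h2 : finrank F (range (ev z)) ≤ N := Submodule.finrank_le _
    have h3 : finrank F (range (ev (Function.argmin f))) ≤ N := Submodule.finrank_le _
    simp only [f] at h1 h3 ⊢
    omega
  -- If `c i y` is not onto, its source has dimension at least that of `R`, so it kills some `u ≠
  -- 0`. Rescaling `z` gives `c i z u` a value outside the range of `c i y`, and the rank can be
  -- raised.
  have hsurj : range (ev y) = ⊤ := by
    by_contra hne
    have hlt := Submodule.finrank_lt hne
    rw [finrank_pi_fintype, Finset.sum_const, Finset.card_univ, Fintype.card_fin, smul_eq_mul]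
      at hlt
    obtain ⟨i, hi⟩ : ∃ i, ¬ Function.Surjective (c i y) := by
      by_contra! hall
      refine hne (LinearMap.range_eq_top.2 fun w => ?_)
      choose v hv using fun i => hall i (w i)
      exact ⟨v, funext hv⟩
    have hrk := (c i y).finrank_range_add_finrank_ker
    have hlt' := Submodule.finrank_lt (mt LinearMap.range_eq_top.1 hi)
    have hge := hcon (β i) (β.ne_zero i)
    have hker : ker (c i y) ≠ ⊥ := fun h => by
      rw [h, finrank_bot] at hrk
      omega
    obtain ⟨u, hu, hu0⟩ := Submodule.exists_mem_ne_zero_of_ne_bot hker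
    obtain ⟨z, hz⟩ : ∃ z, c i z u ≠ 0 := by
      by_contra! hall
      refine hu0 (Subtype.ext (LinearMap.ext fun z => ?_))
      rw [hc, hall, zero_smul]; rfl
    obtain ⟨w, hw⟩ : ∃ w, w ∉ range (c i y) := by
      by_contra! hall
      exact hi hall
    have hwz : c i ((w * (c i z u)⁻¹) • z) u = w := by
      change β.coord i (u.1 ((w * (c i z u)⁻¹) • z)) = w
      rw [map_smul, map_smul, smul_eq_mul]
      exact inv_mul_cancel_right₀ hz w
    obtain ⟨s, hs⟩ := exists_finrank_range_lt (ev y) (ev ((w * (c i z u)⁻¹) • z))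
      (x := Pi.single i u) (by
        refine lt_of_lt_of_le ?_ hF
        have := finrank_range_le (ev y)
        exact_mod_cast Submodule.finrank_lt hne |>.trans_eq (by
          rw [finrank_pi_fintype, Finset.sum_const, Finset.card_univ, Fintype.card_fin,
            smul_eq_mul]))
      (funext fun k => by
        change c k y ((Pi.single i u : ∀ i, endsInto S (β i)) k) = 0
        rcases eq_or_ne k i with rfl | hk
        · rw [Pi.single_eq_same]; exact hu
        · rw [Pi.single_eq_of_ne hk, map_zero])
      (by
        rintro ⟨v, hv⟩
        refine hw ⟨v i, ?_⟩
        have h1 : c i y (v i) = c i _ ((Pi.single i u : ∀ i, endsInto S (β i)) i) := congrFun hv i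
        rw [h1, Pi.single_eq_same, hwz])
    rw [hev] at hs
    exact absurd (hy _) (not_le.2 hs)
  -- Operators reproducing each coordinate of `y` sum to one that fixes `y`. Trivial spectrum forces
  -- `y = 0`, but `ev 0 = 0` is not onto.
  obtain ⟨v, hv⟩ := LinearMap.range_eq_top.1 hsurj fun i => β.coord i y
  have hfix : (∑ i, (v i).1) y = (1 : F) • y := by
    rw [LinearMap.sum_apply, one_smul]
    conv_rhs => rw [← β.sum_repr y]
    refine Finset.sum_congr rfl fun i _ => ?_
    rw [hc]
    exact congrArg (· • β i) (congrFun hv i)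
  have hy0 := hS _ (sum_mem fun i _ => (v i).2.1) 1 one_ne_zero y hfix
  obtain ⟨v', hv'⟩ := LinearMap.range_eq_top.1 hsurj fun _ => 1
  have h1 : β.coord ⟨0, hn⟩ ((v' ⟨0, hn⟩).1 y) = 1 := congrFun hv' ⟨0, hn⟩
  rw [hy0, map_zero, map_zero] at h1
  exact zero_ne_one h1

/-- The endomorphisms of `V ⧸ R ∙ x` induced by the elements of a space with trivial spectrum that
leave the line spanned by `x` invariant constitute a space with trivial spectrum. -/
theorem exists_trivialSpectrum_quotient [FiniteDimensional R V] [FiniteDimensional F V]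
    (S : Submodule F (Module.End R V))
    (hS : ∀ u ∈ S, ∀ c : F, c ≠ 0 → ∀ x : V, u x = c • x → x = 0) (x : V) :
    ∃ T : Submodule F (Module.End R (V ⧸ (R ∙ x))),
      (∀ u ∈ T, ∀ c : F, c ≠ 0 → ∀ x, u x = c • x → x = 0) ∧
      finrank F (endsStabilizing S x) ≤ finrank F T + finrank F (endsInto S x) := by
  have := finiteDimensional_end (F := F) (R := R) (V := V)
  set π := (R ∙ x).mkQ with hπ
  obtain ⟨s, hs⟩ := π.exists_rightInverse_of_surjective (Submodule.range_mkQ _)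
  have hs' (q) : π (s q) = q := congrArg (fun k => k q) hs
  let Θ : Module.End R V →ₗ[F] Module.End R (V ⧸ (R ∙ x)) :=
    { toFun := fun u => π ∘ₗ u ∘ₗ s
      map_add' := fun u v => by ext; simp
      map_smul' := fun c u => LinearMap.ext fun q => LinearMap.map_smul_of_tower π c (u (s q)) }
  have hπ0 (y : V) : π y = 0 ↔ y ∈ R ∙ x := by simp [hπ]
  have hΘ (u) (hu : u ∈ endsStabilizing S x) (y : V) : Θ u (π y) = π (u y) := by
    change π (u (s (π y))) = π (u y)
    rw [← sub_eq_zero, ← map_sub, ← map_sub, hπ0]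
    obtain ⟨r, hr⟩ := Submodule.mem_span_singleton.1
      ((hπ0 (s (π y) - y)).1 (by rw [map_sub, hs', sub_self]))
    rw [← hr, map_smul]
    exact Submodule.smul_mem _ r hu.2
  refine ⟨(endsStabilizing S x).map Θ, ?_, ?_⟩
  · rintro _ ⟨u, hu, rfl⟩ c hc q hq
    obtain ⟨y, rfl⟩ := Submodule.mkQ_surjective _ q
    change Θ u (π y) = c • π y at hq
    change π y = 0
    rw [hΘ u hu, ← LinearMap.map_smul_of_tower, ← sub_eq_zero, ← map_sub, hπ0,
      Submodule.mem_span_singleton] at hq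
    obtain ⟨μ, hμ⟩ := hq
    obtain ⟨α, hα⟩ := Submodule.mem_span_singleton.1 hu.2
    by_cases hαc : α = algebraMap F R c
    · have hx0 : x = 0 := hS u hu.1 c hc x (by rw [← hα, hαc, algebraMap_smul])
      rw [hx0, smul_zero, eq_comm, sub_eq_zero] at hμ
      rw [hS u hu.1 c hc y hμ, map_zero]
    · have hne : algebraMap F R c - α ≠ 0 := sub_ne_zero.2 (Ne.symm hαc)
      -- The coefficient `l` of `x` solves `l * (c - α) = μ`, which turns `y + l • x` into an
      -- eigenvector for `c`.
      have h0 := hS u hu.1 c hc (y + (μ * (algebraMap F R c - α)⁻¹) • x) (by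
        rw [map_add, map_smul, ← hα, eq_add_of_sub_eq hμ.symm, smul_add, add_comm (μ • x), add_assoc,
          smul_smul, ← algebraMap_smul R c ((μ * (algebraMap F R c - α)⁻¹) • x), smul_smul,
          ← add_smul, Algebra.commutes c, ← sub_eq_zero]
        rw [add_sub_add_left_eq_sub, ← sub_smul, add_sub_assoc, ← mul_sub,
          ← neg_sub (algebraMap F R c) α, mul_neg, inv_mul_cancel_right₀ hne, add_neg_cancel, zero_smul])
      rw [hπ0, eq_neg_of_add_eq_zero_left h0]
      exact neg_mem (Submodule.smul_mem _ _ (Submodule.mem_span_singleton_self x))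
  · have h1 := (Θ.domRestrict (endsStabilizing S x)).finrank_range_add_finrank_ker
    rw [LinearMap.range_domRestrict] at h1
    have h2 : finrank F (ker (Θ.domRestrict (endsStabilizing S x))) ≤
        finrank F (endsInto S x) := by
      let f : ker (Θ.domRestrict (endsStabilizing S x)) →ₗ[F] endsInto S x :=
        ((Submodule.subtype _) ∘ₗ (Submodule.subtype _)).codRestrict _ fun u =>
          ⟨u.1.2.1, fun y => by
            have h0 : Θ u.1.1 = 0 := u.2
            exact (hπ0 _).1 (by
              rw [comp_apply, Submodule.subtype_apply, Submodule.subtype_apply, ← hΘ _ u.1.2 y, h0,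
                LinearMap.zero_apply])⟩
      refine finrank_le_finrank_of_injective (f := f) fun u v h => ?_
      have h' : u.1.1 = v.1.1 := congrArg (fun w : endsInto S x => w.1) h
      exact Subtype.ext (Subtype.ext h')
    omega

/-- The greatest possible dimension of a space with trivial spectrum. -/
theorem finrank_add_le_of_trivialSpectrum [FiniteDimensional F R] :
    ∀ (n : ℕ) (V : Type*) [AddCommGroup V] [Module F V] [Module R V] [IsScalarTower F R V]
    [FiniteDimensional R V], finrank R V = n →
    ((n * finrank F R : ℕ) : Cardinal) ≤ Cardinal.mk F →
    ∀ S : Submodule F (Module.End R V),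
    (∀ u ∈ S, ∀ c : F, c ≠ 0 → ∀ x : V, u x = c • x → x = 0) →
    finrank F S + n ≤ finrank F R * (n + 1).choose 2 := by
  intro n
  induction n with
  | zero =>
    intro V _ _ _ _ _ hV _ S _
    have : Module.Finite F V := Module.Finite.trans R V
    have := Submodule.finrank_le S
    have hfd := finiteDimensional_end (F := F) (R := R) (V := V)
    rw [finrank_end, hV] at this
    simpa using this
  | succ n ih =>
    intro V _ _ _ _ _ hV hF S hS
    have : Module.Finite F V := Module.Finite.trans R V
    have hfd := finiteDimensional_end (F := F) (R := R) (V := V)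
    obtain ⟨x, hx, hlt⟩ := exists_finrank_endsInto_lt (by omega) (by rwa [hV]) S hS
    obtain ⟨T, hT, hle⟩ := exists_trivialSpectrum_quotient S hS x
    have hQ : finrank R (V ⧸ (R ∙ x)) = n := by
      have := (R ∙ x).finrank_quotient_add_finrank
      rw [finrank_span_singleton hx] at this
      omega
    have hb := ih (V ⧸ (R ∙ x)) hQ (le_trans (by gcongr; omega) hF) T hT
    -- The kernel of `f` is `endsStabilizing S x`, of dimension at most `finrank F T` plus `finrank
    -- F R - 1`.
    let f : S →ₗ[F] V ⧸ (R ∙ x) :=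
      { toFun := fun u => (R ∙ x).mkQ (u.1 x)
        map_add' := fun u v => by simp
        map_smul' := fun c u => LinearMap.map_smul_of_tower _ c (u.1 x) }
    have h1 := f.finrank_range_add_finrank_ker
    have h2 : finrank F (range f) ≤ finrank F R * n := by
      rw [← hQ, finrank_mul_finrank F R]
      exact Submodule.finrank_le _
    have h3 : finrank F (ker f) ≤ finrank F (endsStabilizing S x) := by
      let g : ker f →ₗ[F] endsStabilizing S x :=
        ((Submodule.subtype _) ∘ₗ (Submodule.subtype _)).codRestrict _ fun u =>
          ⟨u.1.2, by
            have h0 : (R ∙ x).mkQ (u.1.1 x) = 0 := u.2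
            simpa using h0⟩
      refine finrank_le_finrank_of_injective (f := g) fun u v h => ?_
      have h' : u.1.1 = v.1.1 := congrArg (fun w : endsStabilizing S x => w.1) h
      exact Subtype.ext (Subtype.ext h')
    have h4 : (n + 1 + 1).choose 2 = (n + 1) + (n + 1).choose 2 := by
      rw [Nat.choose_succ_succ' (n + 1) 1, Nat.choose_one_right]
    rw [h4, Nat.mul_add, Nat.mul_succ]
    omega

end UpperBound
end TrivialSpectrum

namespace TrivialSpectrum

open Module LinearMap

/-! ### Triangular spaces attaining the bound. -/

section LowerBound

variable {F R V : Type*} [Field F] [DivisionRing R] [Algebra F R] [FiniteDimensional F R]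
  [AddCommGroup V] [Module F V] [Module R V] [IsScalarTower F R V] [FiniteDimensional R V]

/-- With n and d the dimensions of V over R and of R over F, the source has dimension d·n² and the
target n + d·C(n,2). This count serves both the triangular model and the alternating endomorphisms.
-/
theorem le_finrank_ker {M : Type*} [AddCommGroup M] [Module F M] [FiniteDimensional F M]
    (hM : finrank F M = finrank F R)
    (Ψ : Module.End R V →ₗ[F] (Fin (finrank R V) → F) × (∀ i : Fin (finrank R V), Fin i → M)) :
    finrank F R * (finrank R V + 1).choose 2 ≤ finrank F (ker Ψ) + finrank R V := by
  have : Module.Finite F V := Module.Finite.trans R V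
  have := finiteDimensional_end (F := F) (R := R) (V := V)
  have h1 := Ψ.finrank_range_add_finrank_ker
  have h2 := Submodule.finrank_le (range Ψ)
  rw [finrank_prod, finrank_fintype_fun_eq_card, finrank_pi_fintype, Fintype.card_fin] at h2
  simp only [finrank_pi_fintype, Finset.sum_const, Finset.card_univ, Fintype.card_fin,
    smul_eq_mul, hM] at h2
  rw [← Finset.sum_mul, Fin.sum_univ_eq_sum_range (fun i => i)] at h2
  rw [finrank_end] at h1
  generalize finrank R V = n at *
  have h3 : (n + 1).choose 2 + ∑ i ∈ Finset.range n, i = n * n := by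
    clear * -
    induction n with
    | zero => rfl
    | succ n ih =>
      rw [Finset.sum_range_succ, Nat.choose_succ_succ' (n + 1) 1, Nat.choose_one_right]
      linarith
  have h4 : finrank F R * (n + 1).choose 2 + (∑ i ∈ Finset.range n, i) * finrank F R =
      n * (n * finrank F R) := by
    rw [← Nat.mul_assoc, ← h3]; ring
  omega

variable (F R V) in
/-- There is a space with trivial spectrum that has the greatest possible dimension. -/
theorem exists_trivialSpectrum_le_finrank :
    ∃ T : Submodule F (Module.End R V),
      (∀ u ∈ T, ∀ c : F, c ≠ 0 → ∀ x : V, u x = c • x → x = 0) ∧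
      finrank F R * (finrank R V + 1).choose 2 ≤ finrank F T + finrank R V := by
  obtain ⟨e, he⟩ := Module.Projective.exists_dual_ne_zero F (one_ne_zero (α := R))
  set β := finBasis R V
  -- The kernel consists of the upper triangular matrices with diagonal in `ker e`, where `e 1 ≠ 0`.
  let Ψ : Module.End R V →ₗ[F] (Fin (finrank R V) → F) × (∀ i : Fin (finrank R V), Fin i → R) :=
    { toFun := fun u => (fun i => e (β.coord i (u (β i))),
        fun i j => β.coord i (u (β ⟨j, j.2.trans i.2⟩)))
      map_add' := fun u v => by ext <;> simp
      map_smul' := fun c u => by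
        ext <;> simp [LinearMap.map_smul_of_tower] }
  refine ⟨ker Ψ, fun u hu c hc x hx => ?_, le_finrank_ker rfl Ψ⟩
  by_contra hx0
  classical
  obtain ⟨i, hi, hmax⟩ : ∃ i, β.coord i x ≠ 0 ∧ ∀ j, i < j → β.coord j x = 0 := by
    have hne : (Finset.univ.filter fun i => β.coord i x ≠ 0).Nonempty := by
      by_contra! h
      refine hx0 (β.ext_elem fun i => ?_)
      have := Finset.filter_eq_empty_iff.1 h (Finset.mem_univ i)
      simpa using this
    refine ⟨_, (Finset.mem_filter.1 (Finset.max'_mem _ hne)).2, fun j hj => ?_⟩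
    by_contra h
    exact absurd (Finset.le_max' _ j (Finset.mem_filter.2 ⟨Finset.mem_univ j, h⟩)) (not_le.2 hj)
  have hu1 : e (β.coord i (u (β i))) = 0 := congrFun (congrArg Prod.fst hu) i
  have hu2 (j) (hj : j < i) : β.coord i (u (β j)) = 0 :=
    congrFun (congrFun (congrArg Prod.snd hu) i) ⟨j, hj⟩
  -- At the last nonzero coordinate of `x`, the eigenvalue equation forces the diagonal entry to be
  -- `c`, although `e c = c * e 1 ≠ 0`.
  have h1 : β.coord i (u x) = β.coord i x * β.coord i (u (β i)) := by
    conv_lhs => rw [← β.sum_repr x, map_sum, map_sum]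
    rw [Finset.sum_eq_single i]
    · rw [map_smul, map_smul, smul_eq_mul]; rfl
    · intro j _ hj
      rw [map_smul, map_smul]
      rcases lt_or_gt_of_ne hj with h | h
      · rw [hu2 j h, smul_zero]
      · rw [← Basis.coord_apply, hmax j h, zero_smul]
    · simp
  rw [hx, LinearMap.map_smul_of_tower, Algebra.smul_def, Algebra.commutes] at h1
  rw [← mul_left_cancel₀ hi h1, Algebra.algebraMap_eq_smul_one, map_smul, smul_eq_mul] at hu1
  exact (mul_ne_zero hc he) hu1

end LowerBound

/-! ### Optimality and irreducibility of the alternating endomorphisms. -/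

section Forms

variable {F D V : Type*} [Field F] [DivisionRing D] [Algebra F D]
  [AddCommGroup V] [Module F V] [Module Dᵐᵒᵖ V] [IsScalarTower F Dᵐᵒᵖ V]
  {b : LinearMap.BilinForm F V}

theorem hasTrivialSpectrum_alternatingEnd (hb : IsNonisotropic b) :
    HasTrivialSpectrum (alternatingEnd D b) := by
  intro u hu c hc x hx
  by_contra hx0
  have h : b x (u x) = 0 := hu x
  rw [hx, map_smul, smul_eq_mul, mul_eq_zero] at h
  exact h.elim hc (hb x hx0)

variable (F D) in
theorem finrank_mulOpposite : finrank F Dᵐᵒᵖ = finrank F D :=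
  (MulOpposite.opLinearEquiv F).finrank_eq.symm

variable [FiniteDimensional F D] [FiniteDimensional Dᵐᵒᵖ V]

theorem isOptimal_alternatingEnd_iff (hb : IsNonisotropic b)
    (hF : ((finrank Dᵐᵒᵖ V * finrank F D : ℕ) : Cardinal) ≤ Cardinal.mk F) :
    IsOptimal (alternatingEnd D b) ↔ finrank F D * (finrank Dᵐᵒᵖ V + 1).choose 2 ≤
      finrank F (alternatingEnd D b) + finrank Dᵐᵒᵖ V := by
  rw [← finrank_mulOpposite F D] at hF ⊢
  constructor
  · rintro ⟨-, h⟩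
    obtain ⟨T, hT, hle⟩ := exists_trivialSpectrum_le_finrank F Dᵐᵒᵖ V
    exact hle.trans (Nat.add_le_add_right (h T hT) _)
  · refine fun h => ⟨hasTrivialSpectrum_alternatingEnd hb, fun T hT => ?_⟩
    have := finrank_add_le_of_trivialSpectrum _ V rfl hF T hT
    omega

/-- If `alternatingEnd D b` is optimal, then it maps every nonzero vector onto its orthogonal. -/
theorem IsOptimal.exists_apply_eq (hb : IsNonisotropic b)
    (hF : ((finrank Dᵐᵒᵖ V * finrank F D : ℕ) : Cardinal) ≤ Cardinal.mk F)
    (hopt : IsOptimal (alternatingEnd D b)) {x y : V} (hx : x ≠ 0) (hxy : b x y = 0) :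
    ∃ u ∈ alternatingEnd D b, u x = y := by
  have : Module.Finite F V := Module.Finite.trans Dᵐᵒᵖ V
  have hfd := finiteDimensional_end (F := F) (R := Dᵐᵒᵖ) (V := V)
  rw [isOptimal_alternatingEnd_iff hb hF] at hopt
  rw [← finrank_mulOpposite F D] at hF hopt
  let f : alternatingEnd D b →ₗ[F] V :=
    { toFun := fun u => u.1 x
      map_add' := fun u v => rfl
      map_smul' := fun c u => rfl }
  let S := (ker f).map (alternatingEnd D b).subtype
  have hS (u) : u ∈ S ↔ u ∈ alternatingEnd D b ∧ u x = 0 := by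
    constructor
    · rintro ⟨v, hv, rfl⟩
      exact ⟨v.2, hv⟩
    · rintro ⟨h, h0⟩
      exact ⟨⟨u, h⟩, h0, rfl⟩
  obtain ⟨T, hT, hle⟩ := exists_trivialSpectrum_quotient S
    (fun u hu => hasTrivialSpectrum_alternatingEnd hb u ((hS u).1 hu).1) x
  -- Such a `u` has square zero, so the alternating identity at `y + u y` reduces to `b (u y) (u y)
  -- = 0`.
  have h0 : endsInto S x = ⊥ := by
    rw [eq_bot_iff]
    rintro u ⟨hu, hux⟩
    obtain ⟨hua, hux0⟩ := (hS u).1 hu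
    refine LinearMap.ext fun y => ?_
    obtain ⟨α, hα⟩ := Submodule.mem_span_singleton.1 (hux y)
    have huu : u (u y) = 0 := by rw [← hα, map_smul, hux0, smul_zero]
    have h1 : b (y + u y) (u (y + u y)) = 0 := hua _
    have h2 : b y (u y) = 0 := hua _
    rw [map_add u, huu, add_zero, map_add, LinearMap.add_apply, h2, zero_add] at h1
    by_contra h
    exact hb _ h h1
  have h1 : endsStabilizing S x = S := by
    ext u
    refine ⟨fun h => h.1, fun h => ⟨h, ?_⟩⟩
    rw [((hS u).1 h).2]
    exact zero_mem _
  rw [h0, h1, finrank_bot, add_zero, LinearEquiv.finrank_eq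
    (Submodule.equivMapOfInjective _ (Submodule.injective_subtype _) _).symm] at hle
  obtain ⟨n, hn⟩ : ∃ n, finrank Dᵐᵒᵖ V = n + 1 := by
    have : Nontrivial V := ⟨x, 0, hx⟩
    exact Nat.exists_eq_succ_of_ne_zero finrank_pos.ne'
  have hQ : finrank Dᵐᵒᵖ (V ⧸ (Dᵐᵒᵖ ∙ x)) = n := by
    have := (Dᵐᵒᵖ ∙ x).finrank_quotient_add_finrank
    rw [finrank_span_singleton hx] at this
    omega
  have h2 := finrank_add_le_of_trivialSpectrum n (V ⧸ (Dᵐᵒᵖ ∙ x)) hQ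
    (le_trans (by gcongr; omega) hF) T hT
  have h3 := f.finrank_range_add_finrank_ker
  have h4 : (n + 1 + 1).choose 2 = (n + 1) + (n + 1).choose 2 := by
    rw [Nat.choose_succ_succ' (n + 1) 1, Nat.choose_one_right]
  have h5 : finrank F (ker (b x)) < finrank F V := Submodule.finrank_lt fun h =>
    hb x hx (show x ∈ ker (b x) from h ▸ Submodule.mem_top)
  rw [← finrank_mul_finrank F Dᵐᵒᵖ V, hn] at h5
  rw [hn, h4, Nat.mul_add] at hopt
  -- By the count, `f` has rank at least `finrank F V - 1`, and its range lies in this proper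
  -- subspace.
  have h6 : range f = ker (b x) := Submodule.eq_of_le_of_finrank_le
    (by rintro _ ⟨u, rfl⟩; exact u.2 x) (by omega)
  obtain ⟨u, hu⟩ : y ∈ range f := h6 ▸ hxy
  exact ⟨u.1, u.2, hu⟩

-- An invariant subspace containing `x ≠ 0` contains `ker (b x)` and `x` itself, which together span
-- V over F.
omit [FiniteDimensional F D] [FiniteDimensional Dᵐᵒᵖ V] in
theorem isIrreducible_of_exists_apply_eq [Nontrivial V] (hb : IsNonisotropic b)
    (h : ∀ x y : V, x ≠ 0 → b x y = 0 → ∃ u ∈ alternatingEnd D b, u x = y) :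
    IsIrreducible (alternatingEnd D b) := by
  refine ⟨inferInstance, fun W hW => ?_⟩
  by_contra! hne
  obtain ⟨x, hxW, hx⟩ := Submodule.exists_mem_ne_zero_of_ne_bot hne.1
  refine hne.2 (Submodule.eq_top_iff'.2 fun y => ?_)
  obtain ⟨u, hu, hux⟩ := h x (y - (b x y / b x x) • x) hx (by
    rw [map_sub, map_smul, smul_eq_mul, div_mul_cancel₀ _ (hb x hx), sub_self])
  rw [← sub_add_cancel y ((b x y / b x x) • x), ← hux]
  exact add_mem (hW u hu x hxW) (Submodule.smul_of_tower_mem _ _ hxW)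

end Forms
end TrivialSpectrum

namespace TrivialSpectrum

open Module LinearMap

/-! ### Norm involutions force quadratic type. -/

section Involution

/-- `σ` is an `F`-linear antiautomorphism of `D` such that `σ x * x` always belongs to `F`. -/
structure IsNormInvolution (F : Type*) {D : Type*} [Field F] [DivisionRing D] [Algebra F D]
    (σ : D → D) : Prop where
  map_add : ∀ x y, σ (x + y) = σ x + σ y
  map_smul : ∀ (c : F) x, σ (c • x) = c • σ x
  map_one : σ 1 = 1
  map_mul : ∀ x y, σ (x * y) = σ y * σ x
  norm : ∀ x, ∃ c : F, σ x * x = c • 1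

namespace IsNormInvolution

variable {F D : Type*} [Field F] [DivisionRing D] [Algebra F D] {σ : D → D}
  (h : IsNormInvolution F σ)
include h

theorem map_smul_one (c : F) : σ (c • 1) = c • 1 := by rw [h.map_smul, h.map_one]

/-- Expand the norm of `x + 1`. -/
theorem trace (x : D) : ∃ t : F, x + σ x = t • 1 := by
  obtain ⟨n, hn⟩ := h.norm x
  obtain ⟨m, hm⟩ := h.norm (x + 1)
  refine ⟨m - n - 1, ?_⟩
  simp only [h.map_add, h.map_one, mul_add, add_mul, one_mul, mul_one, hn] at hm
  linear_combination (norm := module) hm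

theorem involutive (x : D) : σ (σ x) = x := by
  obtain ⟨t, ht⟩ := h.trace x
  have h1 := congrArg σ ht
  rw [h.map_add, h.map_smul_one, ← ht, add_comm x] at h1
  exact add_left_cancel h1

theorem mul_self (x : D) : ∃ t n : F, x + σ x = t • 1 ∧ σ x * x = n • 1 ∧
    x * x = t • x - n • 1 := by
  obtain ⟨t, ht⟩ := h.trace x
  obtain ⟨n, hn⟩ := h.norm x
  refine ⟨t, n, ht, hn, ?_⟩
  rw [← hn, ← one_mul x, ← smul_mul_assoc, one_mul, ← ht, add_mul, add_sub_cancel_right]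

theorem mul_comm_self (x : D) : x * σ x = σ x * x := by
  obtain ⟨t, ht⟩ := h.trace x
  have h1 : σ x = t • 1 - x := by rw [← ht, add_sub_cancel_left]
  rw [h1, mul_sub, sub_mul, smul_mul_assoc, mul_smul_comm, one_mul, mul_one]

theorem polar (x y : D) : ∃ c : F, σ x * y + σ y * x = c • 1 := by
  obtain ⟨k, hk⟩ := h.norm (x + y)
  obtain ⟨m, hm⟩ := h.norm x
  obtain ⟨n, hn⟩ := h.norm y
  refine ⟨k - m - n, ?_⟩
  rw [h.map_add, mul_add, add_mul, add_mul, hm, hn] at hk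
  linear_combination (norm := module) hk

/-- The trace of `x * y` is a scalar, hence commutes with `x`; since `σ x * x = x * σ x` is a scalar
too, `x` can be carried across and cancelled. -/
theorem trace_mul_comm (x y : D) : x * y + σ (x * y) = y * x + σ (y * x) := by
  rcases eq_or_ne x 0 with rfl | hx
  · simp
  obtain ⟨t, ht⟩ := h.trace (x * y)
  obtain ⟨n, hn⟩ := h.norm x
  have hn' : x * σ x = n • 1 := by rw [h.mul_comm_self, hn]
  refine mul_left_cancel₀ hx ?_
  have h1 : x * (x * y + σ (x * y)) = (x * y + σ (x * y)) * x := by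
    rw [ht, mul_smul_comm, smul_mul_assoc, mul_one, one_mul]
  rw [h1, h.map_mul x y, h.map_mul y x, add_mul, mul_add, mul_assoc (σ y), hn, ← mul_assoc x (σ x),
    hn', mul_smul_comm, smul_mul_assoc, mul_one, one_mul, mul_assoc]

/-- A nonscalar element satisfies only one monic quadratic equation over F, and this determines its
trace. -/
theorem eq_of_isNormInvolution {τ : D → D} (h' : IsNormInvolution F τ) : σ = τ := by
  funext x
  by_cases hx : ∃ c : F, x = c • 1
  · obtain ⟨c, rfl⟩ := hx
    rw [h.map_smul_one, h'.map_smul_one]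
  · obtain ⟨t, n, ht, -, hx1⟩ := h.mul_self x
    obtain ⟨t', n', ht', -, hx2⟩ := h'.mul_self x
    have h1 : (t - t') • x = (n - n') • (1 : D) := by
      rw [hx1] at hx2
      linear_combination (norm := module) hx2
    have h2 : t = t' := by
      by_contra hne
      have hne := sub_ne_zero.2 hne
      exact hx ⟨(t - t')⁻¹ * (n - n'), by rw [mul_smul, ← h1, smul_smul, inv_mul_cancel₀ hne,
        one_smul]⟩
    rw [h2, ← ht'] at ht
    exact add_left_cancel ht

-- The square of `x - σ x` is the discriminant, in characteristic 2 as well.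
omit h in
theorem disc_ne_zero {x : D} (hx : σ x ≠ x) {t n : F} (ht : x + σ x = t • 1)
    (hn : x * x = t • x - n • 1) : t ^ 2 - 4 * n ≠ 0 := by
  intro h0
  have h1 : (x - σ x) * (x - σ x) = (t ^ 2 - 4 * n) • 1 := by
    have : σ x = t • 1 - x := by rw [← ht, add_sub_cancel_left]
    rw [this]
    simp only [mul_sub, sub_mul, smul_mul_assoc, mul_smul_comm, one_mul, mul_one, hn]
    module
  rw [h0, zero_smul, mul_self_eq_zero, sub_eq_zero] at h1
  exact hx h1.symm

/-- The polar identity becomes `(i - σ i) * y = s • i - c • 1`; multiplying by `i - σ i`, whose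
square is a nonzero scalar, isolates `y`. -/
theorem eq_of_commute {i y : D} (hi : σ i ≠ i) (hy : y * i = i * y) :
    ∃ p q : F, y = p • 1 + q • i := by
  obtain ⟨t, n, ht, -, hii⟩ := h.mul_self i
  obtain ⟨s, hs⟩ := h.trace y
  obtain ⟨c, hc⟩ := h.polar i y
  have hdisc := disc_ne_zero hi ht hii
  have h1 : σ i = t • 1 - i := by rw [← ht, add_sub_cancel_left]
  have h2 : σ y = s • 1 - y := by rw [← hs, add_sub_cancel_left]
  rw [h1, h2, sub_mul, sub_mul, hy, smul_mul_assoc, smul_mul_assoc, one_mul, one_mul] at hc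
  have h3 : (i - σ i) * ((t ^ 2 - 4 * n) • y) =
      (i - σ i) * ((t * s - 2 * c) • i + (t * c - 2 * s * n) • 1) := by
    have h4 : (i - σ i) * y = s • i - c • 1 := by
      rw [h1, ← sub_add, sub_add_eq_add_sub, sub_mul, add_mul, smul_mul_assoc, one_mul]
      linear_combination (norm := module) -hc
    rw [mul_smul_comm, h4, h1]
    simp only [mul_add, sub_mul, smul_mul_assoc, mul_smul_comm, one_mul, mul_one, hii]
    module
  have h5 := mul_left_cancel₀ (sub_ne_zero.2 (Ne.symm hi)) h3
  refine ⟨(t ^ 2 - 4 * n)⁻¹ * (t * c - 2 * s * n), (t ^ 2 - 4 * n)⁻¹ * (t * s - 2 * c), ?_⟩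
  rw [mul_smul, mul_smul, ← smul_add, add_comm, ← h5, smul_smul, inv_mul_cancel₀ hdisc, one_smul]

theorem not_mem_of_ne {i : D} (hi : σ i ≠ i) {p q : F} (hpq : p • (1 : D) + q • i = 0) :
    p = 0 ∧ q = 0 := by
  have hq : q = 0 := by
    by_contra hq
    refine hi ?_
    have : i = (-(q⁻¹ * p)) • 1 := by
      rw [neg_smul, mul_smul, eq_neg_of_add_eq_zero_left hpq, smul_neg, neg_neg, smul_smul,
        inv_mul_cancel₀ hq, one_smul]
    rw [this, h.map_smul_one]
  subst hq
  rw [zero_smul, add_zero, smul_eq_zero] at hpq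
  exact ⟨hpq.resolve_right one_ne_zero, rfl⟩

theorem isSeparableQuadratic (hD : ∀ x y : D, x * y = y * x) {i : D} (hi : σ i ≠ i) :
    IsSeparableQuadratic F D := by
  constructor
  · let f : (F × F) →ₗ[F] D :=
      { toFun := fun p => p.1 • 1 + p.2 • i
        map_add' := fun p q => by simp only [Prod.fst_add, Prod.snd_add]; module
        map_smul' := fun c p => by
          simp only [Prod.smul_fst, Prod.smul_snd, smul_eq_mul, RingHom.id_apply]; module }
    have hf : Function.Bijective f := by
      constructor
      · rw [injective_iff_map_eq_zero]
        rintro ⟨p, q⟩ hpq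
        obtain ⟨rfl, rfl⟩ := h.not_mem_of_ne hi hpq
        rfl
      · intro y
        obtain ⟨p, q, rfl⟩ := h.eq_of_commute hi (hD y i)
        exact ⟨(p, q), rfl⟩
    rw [← (LinearEquiv.ofBijective f hf).finrank_eq]
    simp
  · refine ⟨fun y => ?_⟩
    by_cases hy : σ y = y
    · obtain ⟨p, q, rfl⟩ := h.eq_of_commute hi (hD y i)
      rw [h.map_add, h.map_smul_one, h.map_smul] at hy
      have hq : q = 0 := by
        by_contra hq
        exact hi (smul_right_injective D hq (add_left_cancel hy))
      rw [hq, zero_smul, add_zero, ← Algebra.algebraMap_eq_smul_one]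
      exact isSeparable_algebraMap p
    · obtain ⟨t, n, ht, -, hyy⟩ := h.mul_self y
      have hdisc := disc_ne_zero hy ht hyy
      let f : Polynomial F := Polynomial.X ^ 2 - Polynomial.C t * Polynomial.X + Polynomial.C n
      refine Polynomial.Separable.of_dvd (f := f) ?_ (minpoly.dvd F y ?_)
      -- Bézout relation: f'² − 4f = t² − 4n.
      · refine ⟨Polynomial.C (-4 / (t ^ 2 - 4 * n)), Polynomial.C (1 / (t ^ 2 - 4 * n)) *
          Polynomial.derivative f, ?_⟩
        have hd : Polynomial.derivative f = 2 * Polynomial.X - Polynomial.C t := by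
          simp only [f, Polynomial.derivative_add, Polynomial.derivative_sub,
            Polynomial.derivative_X_sq, Polynomial.derivative_C_mul, Polynomial.derivative_X,
            Polynomial.derivative_C, mul_one, add_zero, map_ofNat]
        have h1 : Polynomial.C (t ^ 2 - 4 * n)⁻¹ * Polynomial.C (t ^ 2 - 4 * n) = 1 := by
          rw [← Polynomial.C_mul, inv_mul_cancel₀ hdisc, Polynomial.C_1]
        rw [hd, div_eq_mul_inv, one_div, Polynomial.C_mul, Polynomial.C_neg, map_ofNat]
        rw [Polynomial.C_sub (a := t ^ 2), Polynomial.C_mul, Polynomial.C_pow, map_ofNat] at h1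
        linear_combination h1
      · change Polynomial.aeval y
          (Polynomial.X ^ 2 - Polynomial.C t * Polynomial.X + Polynomial.C n) = 0
        simp only [_root_.map_add, map_sub, _root_.map_mul, Polynomial.aeval_X, Polynomial.aeval_C,
          pow_two, hyy, Algebra.algebraMap_eq_smul_one, smul_mul_assoc, one_mul]
        module

/-- Here D is commutative with all squares in F. If 2 ≠ 0, the trace `2x` puts x in F; otherwise D
is purely inseparable and its degree is a power of 2. -/
theorem isQuadraticType_of_eq_id [FiniteDimensional F D] (hσ : ∀ x, σ x = x) :
    IsQuadraticType F D := by
  have hD (x y : D) : x * y = y * x := by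
    rw [← hσ (x * y), h.map_mul, hσ, hσ]
  by_cases h2 : (2 : F) = 0
  · by_cases h1 : finrank F D = 1
    · exact Or.inl h1
    have : CharP F 2 := CharTwo.of_one_ne_zero_of_two_eq_zero one_ne_zero h2
    have hsq (x : D) : ∃ c : F, x ^ 2 = algebraMap F D c := by
      obtain ⟨c, hc⟩ := h.norm x
      exact ⟨c, by rw [pow_two, Algebra.algebraMap_eq_smul_one, ← hc, hσ]⟩
    refine Or.inr (Or.inr (Or.inr ⟨this, ?_, hD, hsq⟩))
    let : Field D := { ‹DivisionRing D› with mul_comm := hD }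
    have : ExpChar F 2 := ExpChar.prime Nat.prime_two
    have : IsPurelyInseparable F D := (isPurelyInseparable_iff_pow_mem F 2).2 fun x => by
      obtain ⟨c, hc⟩ := hsq x
      exact ⟨1, c, by rw [pow_one, hc]⟩
    obtain ⟨m, hm⟩ := IsPurelyInseparable.finrank_eq_pow F D 2
    refine ⟨m, Nat.one_le_iff_ne_zero.2 ?_, hm⟩
    rintro rfl
    exact h1 hm
  · refine Or.inl (finrank_eq_one (1 : D) one_ne_zero fun x => ?_)
    obtain ⟨t, ht⟩ := h.trace x
    refine ⟨2⁻¹ * t, ?_⟩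
    rw [mul_smul, ← ht, hσ, ← two_smul F, smul_smul, inv_mul_cancel₀ h2, one_smul]

/-- The commutator `j = y * i - i * y` conjugates `i` to `σ i`, and D is the direct sum of F(i) and
F(i)j. -/
theorem isQuaternionAlgebra {i y : D} (hi : σ i ≠ i) (hy : y * i ≠ i * y) :
    finrank F D = 4 ∧ IsQuaternionAlgebra F D := by
  obtain ⟨t, n, ht, -, hii⟩ := h.mul_self i
  have hdisc := disc_ne_zero hi ht hii
  have hσi : σ i = t • 1 - i := by rw [← ht, add_sub_cancel_left]
  have hδ : i - σ i ≠ 0 := sub_ne_zero.2 (Ne.symm hi)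
  obtain ⟨j, hj0, hj⟩ : ∃ j : D, j ≠ 0 ∧ j * i = σ i * j := by
    refine ⟨y * i - i * y, sub_ne_zero.2 hy, ?_⟩
    rw [hσi]
    simp only [sub_mul, mul_sub, mul_assoc, hii, smul_mul_assoc, mul_smul_comm, one_mul, mul_one]
    rw [← mul_assoc i i y, hii, sub_mul, smul_mul_assoc, smul_mul_assoc, one_mul]
    module
  -- `j * j` commutes with `i` and `j` does not, so the trace of `j` vanishes.
  have hjj : ∃ c : F, j * j = c • 1 := by
    obtain ⟨s, m, -, -, hjj⟩ := h.mul_self j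
    have hs : s = 0 := by
      by_contra hs
      have h1 : j * j * i = i * (j * j) := by
        have h2 : j * σ i = i * j := by
          rw [hσi, mul_sub, hj, hσi, mul_smul_comm, sub_mul, smul_mul_assoc, mul_one, one_mul,
            sub_sub_cancel]
        rw [mul_assoc, hj, ← mul_assoc, h2, mul_assoc]
      rw [hjj, sub_mul, mul_sub, smul_mul_assoc, smul_mul_assoc, mul_smul_comm, mul_smul_comm,
        one_mul, mul_one, sub_left_inj] at h1
      have h2 : j * i = i * j := smul_right_injective D hs h1
      rw [hj] at h2
      exact hi (mul_right_cancel₀ hj0 h2)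
    exact ⟨-m, by rw [hjj, hs, zero_smul, zero_sub, neg_smul]⟩
  obtain ⟨c, hc⟩ := hjj
  have hc0 : c ≠ 0 := by
    rintro rfl
    rw [zero_smul, mul_self_eq_zero] at hc
    exact hj0 hc
  let B : QuaternionAlgebra.Basis D (-n) t c :=
    { i := i
      j := j
      k := i * j
      i_mul_i := by rw [hii]; module
      j_mul_j := hc
      i_mul_j := rfl
      j_mul_i := by rw [hj, hσi, sub_mul, smul_mul_assoc, one_mul] }
  have hlift (p q r s : F) : B.liftHom ⟨p, q, r, s⟩ = (p • 1 + q • i) + (r • 1 + s • i) * j := by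
    simp only [QuaternionAlgebra.Basis.liftHom_apply, QuaternionAlgebra.Basis.lift, B]
    rw [Algebra.algebraMap_eq_smul_one, add_mul, smul_mul_assoc, smul_mul_assoc, one_mul, add_assoc]
  have hcomm (p q : F) : (p • 1 + q • i) * i = i * (p • 1 + q • i) := by
    simp only [add_mul, mul_add, smul_mul_assoc, mul_smul_comm, one_mul, mul_one]
  have hbij : Function.Bijective B.liftHom := by
    constructor
    · rw [injective_iff_map_eq_zero]
      rintro ⟨p, q, r, s⟩ h0
      rw [hlift] at h0
      have h1 : p • 1 + q • i = -((r • 1 + s • i) * j) := eq_neg_of_add_eq_zero_left h0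
      -- The first summand commutes with `i`, while the second satisfies `w * i = σ i * w`; hence
      -- both vanish.
      have h2 : (p • 1 + q • i) * i = σ i * (p • 1 + q • i) := by
        rw [h1, mul_neg, neg_mul, mul_assoc, hj, ← mul_assoc, ← mul_assoc, hσi, mul_sub,
          sub_mul (t • 1), hcomm, smul_one_mul, mul_smul_one]
      have h3 : (i - σ i) * (p • 1 + q • i) = 0 := by
        rw [sub_mul, ← h2, hcomm, sub_self]
      have h4 := (mul_eq_zero.1 h3).resolve_left hδ
      rw [h4, zero_add, mul_eq_zero] at h0
      obtain ⟨rfl, rfl⟩ := h.not_mem_of_ne hi h4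
      obtain ⟨rfl, rfl⟩ := h.not_mem_of_ne hi (h0.resolve_right hj0)
      rfl
    · intro z
      have hiσ (w : D) : w * σ i = t • w - w * i := by
        rw [hσi, mul_sub, mul_smul_comm, mul_one]
      have hσi' (w : D) : σ i * w = t • w - i * w := by
        rw [hσi, sub_mul, smul_mul_assoc, one_mul]
      have hii' (w : D) : i * (i * w) = t • (i * w) - n • w := by
        rw [← mul_assoc, hii, sub_mul, smul_mul_assoc, smul_mul_assoc, one_mul]
      -- `(i - σ i) * z` is `z * i - σ i * z`, which commutes with `i`, minus `z * i - i * z`, which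
      -- does so once multiplied by `j⁻¹`. A second factor `i - σ i` then gives a nonzero scalar
      -- multiple of `z`.
      obtain ⟨p, q, hpq⟩ := h.eq_of_commute (y := z * i - σ i * z) hi (by
        simp only [hσi', sub_mul, mul_sub, mul_assoc, hii, hii', mul_smul_comm, smul_mul_assoc,
          mul_one]
        module)
      obtain ⟨r, s, hrs⟩ := h.eq_of_commute (y := (z * i - i * z) * j⁻¹) hi (by
        have h1 : j⁻¹ * i = σ i * j⁻¹ := by
          rw [inv_mul_eq_iff_eq_mul₀ hj0, ← mul_assoc, hiσ, hj, hσi', sub_sub_cancel,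
            mul_inv_cancel_right₀ hj0]
        rw [mul_assoc, h1, ← mul_assoc, ← mul_assoc, hiσ]
        congr 1
        simp only [sub_mul, mul_sub, mul_assoc, hii, hii', mul_smul_comm, mul_one]
        module)
      have h1 : (i - σ i) * z = B.liftHom ⟨p, q, -r, -s⟩ := by
        rw [hlift, ← hpq, show (-r) • (1 : D) + (-s) • i = -(r • 1 + s • i) by module, ← hrs,
          neg_mul, inv_mul_cancel_right₀ hj0, sub_mul]
        abel
      have h2 : i - σ i = B.liftHom ⟨-t, 2, 0, 0⟩ := by
        rw [hlift, hσi, zero_smul, zero_smul, add_zero, zero_mul]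
        module
      refine ⟨(t ^ 2 - 4 * n)⁻¹ • (⟨-t, 2, 0, 0⟩ * ⟨p, q, -r, -s⟩), ?_⟩
      rw [_root_.map_smul, _root_.map_mul, ← h1, ← h2, inv_smul_eq_iff₀ hdisc]
      simp only [hσi, sub_mul, mul_sub, hii', smul_mul_assoc, mul_smul_comm, one_mul]
      module
  let φ := AlgEquiv.ofBijective B.liftHom hbij
  refine ⟨?_, -n, t, c, φ.symm, ?_, hc0⟩
  · rw [← φ.toLinearEquiv.finrank_eq, QuaternionAlgebra.finrank_eq_four]
  · rwa [mul_neg, ← sub_eq_add_neg]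

theorem isQuadraticType [FiniteDimensional F D] : IsQuadraticType F D := by
  by_cases hσ : ∀ x, σ x = x
  · exact h.isQuadraticType_of_eq_id hσ
  push Not at hσ
  obtain ⟨i, hi⟩ := hσ
  by_cases hi' : ∀ y, y * i = i * y
  · refine Or.inr (Or.inl (h.isSeparableQuadratic (fun x y => ?_) hi))
    obtain ⟨p, q, rfl⟩ := h.eq_of_commute hi (hi' x)
    simp only [add_mul, mul_add, smul_mul_assoc, mul_smul_comm, one_mul, mul_one, hi']
  · push Not at hi'
    obtain ⟨y, hy⟩ := hi'
    exact Or.inr (Or.inr (Or.inl (h.isQuaternionAlgebra hi hy)))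

end IsNormInvolution
end Involution
end TrivialSpectrum

namespace TrivialSpectrum

open Module LinearMap

/-! ### Associated pairs: common properties and existence. -/

section AssociatedPair

variable {F D : Type*} [Field F] [DivisionRing D] [Algebra F D] {σ : D → D} {e : D →ₗ[F] F}

theorem regularTrace_mul_comm (x y : D) : regularTrace F D (x * y) = regularTrace F D (y * x) := by
  simp only [regularTrace, LinearMap.comp_apply]
  have h (x y : D) : LinearMap.mul F D (x * y) = LinearMap.mul F D x * LinearMap.mul F D y := by
    ext z; simp [mul_assoc]
  rw [h, h, LinearMap.trace_mul_comm]

theorem regularTrace_algEquiv (τ : D ≃ₐ[F] D) (x : D) :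
    regularTrace F D (τ x) = regularTrace F D x := by
  simp only [regularTrace, LinearMap.comp_apply]
  rw [← LinearMap.trace_conj' (LinearMap.mul F D x) τ.toLinearEquiv]
  congr 1
  ext z
  simp [LinearEquiv.conj_apply]

theorem isNormInvolution_of_finrank_eq_one (h1 : finrank F D = 1) :
    IsNormInvolution F (id : D → D) := by
  have hD := (finrank_eq_one_iff_of_nonzero' (1 : D) one_ne_zero).1 h1
  refine ⟨fun _ _ => rfl, fun _ _ => rfl, rfl, fun x y => ?_, fun x => ?_⟩
  · obtain ⟨c, rfl⟩ := hD x
    simp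
  · obtain ⟨c, hc⟩ := hD (x * x)
    exact ⟨c, hc.symm⟩

theorem isNormInvolution_of_isHyperRadicial (h : IsHyperRadicial F D) :
    IsNormInvolution F (id : D → D) := by
  obtain ⟨-, -, hD, hsq⟩ := h
  refine ⟨fun _ _ => rfl, fun _ _ => rfl, rfl, fun x y => hD x y, fun x => ?_⟩
  obtain ⟨c, hc⟩ := hsq x
  exact ⟨c, by rw [id_eq, ← pow_two, hc, Algebra.algebraMap_eq_smul_one]⟩

theorem exists_eq_of_finrank_eq_two (h2 : finrank F D = 2) {i : D} (hi : ∀ c : F, i ≠ c • 1)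
    (y : D) : ∃ p q : F, y = p • 1 + q • i := by
  let f : (F × F) →ₗ[F] D :=
    { toFun := fun p => p.1 • 1 + p.2 • i
      map_add' := fun p q => by simp only [Prod.fst_add, Prod.snd_add]; module
      map_smul' := fun c p => by
        simp only [Prod.smul_fst, Prod.smul_snd, smul_eq_mul, RingHom.id_apply]; module }
  have hf : Function.Injective f := by
    rw [injective_iff_map_eq_zero]
    rintro ⟨p, q⟩ hpq
    change p • 1 + q • i = 0 at hpq
    have hq : q = 0 := by
      by_contra hq
      refine hi (-(q⁻¹ * p)) ?_
      rw [neg_smul, mul_smul, eq_neg_of_add_eq_zero_left hpq, smul_neg, neg_neg, smul_smul,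
        inv_mul_cancel₀ hq, one_smul]
    subst hq
    rw [zero_smul, add_zero, smul_eq_zero] at hpq
    rw [hpq.resolve_right one_ne_zero]
    rfl
  have : FiniteDimensional F D := .of_finrank_pos (by omega)
  obtain ⟨p, hp⟩ := (LinearMap.injective_iff_surjective_of_finrank_eq_finrank
    (by rw [h2]; simp)).1 hf y
  exact ⟨p.1, p.2, hp.symm⟩

theorem mul_comm_of_finrank_eq_two (h2 : finrank F D = 2) (x y : D) : x * y = y * x := by
  by_cases hx : ∃ c : F, x = c • 1
  · obtain ⟨c, rfl⟩ := hx
    rw [smul_one_mul, mul_smul_one]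
  · push Not at hx
    obtain ⟨p, q, rfl⟩ := exists_eq_of_finrank_eq_two h2 hx y
    simp only [add_mul, mul_add, smul_mul_assoc, mul_smul_comm, one_mul, mul_one]

/-- If `i * i = p • 1 + q • i`, subtracting the image under τ and cancelling `τ i - i` gives `τ i +
i = q • 1`. -/
theorem isNormInvolution_of_finrank_eq_two (h2 : finrank F D = 2) {τ : D ≃ₐ[F] D}
    (hτ : τ ≠ AlgEquiv.refl) : IsNormInvolution F (τ : D → D) := by
  obtain ⟨i, hi⟩ : ∃ i, τ i ≠ i := by
    by_contra! h
    exact hτ (AlgEquiv.ext h)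
  have hspan := exists_eq_of_finrank_eq_two h2 (i := i) (by
    rintro c rfl
    exact hi (by rw [map_smul, map_one]))
  have hcomm := mul_comm_of_finrank_eq_two h2
  refine ⟨map_add τ, map_smul τ, map_one τ, fun x y => by rw [map_mul, hcomm], fun y => ?_⟩
  obtain ⟨p, q, hii⟩ := hspan (i * i)
  have h1 : τ i = q • 1 - i := by
    have h3 := congrArg τ hii
    simp only [map_mul, map_add, map_smul, map_one] at h3
    refine eq_sub_of_add_eq (mul_right_cancel₀ (sub_ne_zero.2 hi) ?_)
    rw [add_mul, mul_sub, mul_sub, hcomm i (τ i), h3, hii, smul_mul_assoc, one_mul]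
    module
  obtain ⟨r, s, rfl⟩ := hspan y
  refine ⟨r ^ 2 + r * s * q - s ^ 2 * p, ?_⟩
  rw [map_add, map_smul, map_smul, map_one, h1]
  simp only [add_mul, mul_add, smul_mul_assoc, mul_smul_comm, one_mul, mul_one, smul_sub, sub_mul,
    hii]
  module

theorem isNormInvolution_of_quaternion {a b c : F} (φ : D ≃ₐ[F] ℍ[F,a,b,c])
    (hσ : ∀ x, φ (σ x) = star (φ x)) : IsNormInvolution F σ := by
  refine ⟨fun x y => φ.injective ?_, fun r x => φ.injective ?_, φ.injective ?_,
    fun x y => φ.injective ?_, fun x => ⟨(star (φ x) * φ x).re, φ.injective ?_⟩⟩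
  · simp [hσ]
  · simp [hσ]
  · simp [hσ]
  · simp [hσ]
  · rw [map_mul, hσ, map_smul, map_one, QuaternionAlgebra.star_mul_eq_coe,
      ← Algebra.algebraMap_eq_smul_one]
    rfl

theorem regularTrace_ne_zero_of_finrank_eq_one (h1 : finrank F D = 1) : regularTrace F D ≠ 0 := by
  intro h
  have : FiniteDimensional F D := .of_finrank_pos (by omega)
  have h2 : regularTrace F D 1 = 1 := by
    have : LinearMap.mul F D 1 = LinearMap.id := by ext; simp
    rw [regularTrace, LinearMap.comp_apply, this, LinearMap.trace_id, h1, Nat.cast_one]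
  rw [h] at h2
  exact zero_ne_one h2

theorem regularTrace_ne_zero_of_isSeparableQuadratic (h : IsSeparableQuadratic F D) :
    regularTrace F D ≠ 0 := by
  have : FiniteDimensional F D := .of_finrank_pos (by rw [h.1]; norm_num)
  let : Field D := { ‹DivisionRing D› with mul_comm := mul_comm_of_finrank_eq_two h.1 }
  have := h.2
  exact Algebra.trace_ne_zero F D

theorem exists_algEquiv_of_isSeparableQuadratic (h : IsSeparableQuadratic F D) :
    ∃ τ : D ≃ₐ[F] D, τ ≠ AlgEquiv.refl := by
  have : FiniteDimensional F D := .of_finrank_pos (by rw [h.1]; norm_num)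
  let : Field D := { ‹DivisionRing D› with mul_comm := mul_comm_of_finrank_eq_two h.1 }
  have := h.2
  have : Algebra.IsQuadraticExtension F D := ⟨h.1⟩
  have : IsGalois F D := ⟨⟩
  have hcard := IsGalois.card_aut_eq_finrank F D
  rw [h.1] at hcard
  have : Nontrivial (D ≃ₐ[F] D) := by
    rw [← Finite.one_lt_card_iff_nontrivial, hcard]
    norm_num
  exact exists_ne 1

/-- The trace form of a quaternion algebra is nonzero. -/
theorem ne_zero_of_isQuaternionAlgebra (h : IsNormInvolution F σ) (hD : IsQuaternionAlgebra F D)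
    (he : ∀ x, algebraMap F D (e x) = x + σ x) : e ≠ 0 := by
  rintro rfl
  have he (x) : x + σ x = 0 := by rw [← he, LinearMap.zero_apply, map_zero]
  have h2 : (1 : D) + 1 = 0 := by rw [← he 1, h.map_one]
  have hσ (x) : σ x = x := by
    have : x + x = 0 := by rw [← mul_one x, ← mul_add, h2, mul_zero]
    exact add_left_cancel ((he x).trans this.symm)
  have hcomm (x y : D) : x * y = y * x := by
    have := h.map_mul x y
    rwa [hσ, hσ, hσ] at this
  obtain ⟨a, b, c, φ, hdisc, -⟩ := hD
  have hcomm' (x y : ℍ[F,a,b,c]) : x * y = y * x := by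
    have := congrArg φ (hcomm (φ.symm x) (φ.symm y))
    simpa using this
  -- Commutation of the basis elements j and i forces `b = 0` and `-1 = 1`.
  have h1 := hcomm' ⟨0, 0, 1, 0⟩ ⟨0, 1, 0, 0⟩
  have h3 := congrArg QuaternionAlgebra.imJ h1
  have h4 := congrArg QuaternionAlgebra.imK h1
  simp at h3 h4
  apply hdisc
  rw [h3]
  linear_combination (-2 * a) * h4

/-- What the proof uses of an associated pair. -/
structure IsTracePair (σ : D → D) (e : D →ₗ[F] F) : Prop where
  isNormInvolution : IsNormInvolution F σ
  ne_zero : e ≠ 0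
  mul_comm : ∀ x y, e (x * y) = e (y * x)
  apply_involution : ∀ x, e (σ x) = e x

theorem IsNormInvolution.isTracePair (h : IsNormInvolution F σ) (h0 : e ≠ 0)
    (he : ∀ x, algebraMap F D (e x) = x + σ x) : IsTracePair σ e := by
  refine ⟨h, h0, fun x y => (algebraMap F D).injective ?_, fun x => (algebraMap F D).injective ?_⟩
  · rw [he, he, h.trace_mul_comm]
  · rw [he, he, h.involutive, add_comm]

theorem IsAssociatedPair.isTracePair (h : IsAssociatedPair F D σ e) : IsTracePair σ e := by
  obtain ⟨-, hσ, h1, h2, h3, h4⟩ := h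
  rcases hσ with ⟨hD, rfl⟩ | ⟨hD, τ, hτ, rfl⟩ | ⟨hD, a, b, c, φ, hφ, hσ⟩ | ⟨hD, rfl⟩
  · exact ⟨isNormInvolution_of_finrank_eq_one hD,
      h1 hD ▸ regularTrace_ne_zero_of_finrank_eq_one hD,
      fun x y => by rw [h1 hD, regularTrace_mul_comm], fun x => rfl⟩
  · exact ⟨isNormInvolution_of_finrank_eq_two hD.1 hτ,
      h2 hD ▸ regularTrace_ne_zero_of_isSeparableQuadratic hD,
      fun x y => by rw [h2 hD, regularTrace_mul_comm],
      fun x => by rw [h2 hD, regularTrace_algEquiv]⟩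
  · have hN := isNormInvolution_of_quaternion φ hσ
    have hq : IsQuaternionAlgebra F D := ⟨a, b, c, φ, hφ⟩
    exact hN.isTracePair (ne_zero_of_isQuaternionAlgebra hN hq (h3 ⟨hD, hq⟩)) (h3 ⟨hD, hq⟩)
  · exact ⟨isNormInvolution_of_isHyperRadicial hD, h4 hD,
      fun x y => by rw [hD.2.2.1], fun x => rfl⟩

theorem IsNormInvolution.exists_traceForm (h : IsNormInvolution F σ) :
    ∃ e : D →ₗ[F] F, ∀ x, algebraMap F D (e x) = x + σ x := by
  choose t ht using h.trace
  have hinj : Function.Injective fun c : F => c • (1 : D) := smul_left_injective F one_ne_zero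
  refine ⟨{ toFun := t, map_add' := fun x y => hinj ?_, map_smul' := fun c x => hinj ?_ },
    fun x => ?_⟩
  · simp only [add_smul, ← ht, h.map_add]; abel
  · simp only [RingHom.id_apply, smul_eq_mul, mul_smul, ← ht, h.map_smul, smul_add]
  · exact (Algebra.algebraMap_eq_smul_one _).trans (ht x).symm

theorem exists_isAssociatedPair (h : IsQuadraticType F D) :
    ∃ (σ : D → D) (e : D →ₗ[F] F), IsAssociatedPair F D σ e := by
  by_cases h1 : finrank F D = 1
  · exact ⟨id, regularTrace F D, h, Or.inl ⟨h1, rfl⟩, fun _ => rfl, fun _ => rfl,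
      fun h4 => by omega, fun _ => regularTrace_ne_zero_of_finrank_eq_one h1⟩
  by_cases h2 : IsSeparableQuadratic F D
  · obtain ⟨τ, hτ⟩ := exists_algEquiv_of_isSeparableQuadratic h2
    have := h2.1
    exact ⟨τ, regularTrace F D, h, Or.inr (Or.inl ⟨h2, τ, hτ, rfl⟩), fun _ => rfl, fun _ => rfl,
      fun h4 => by omega, fun _ => regularTrace_ne_zero_of_isSeparableQuadratic h2⟩
  by_cases h3 : finrank F D = 4 ∧ IsQuaternionAlgebra F D
  · obtain ⟨hD, a, b, c, φ, hφ⟩ := h3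
    have hσ (x : D) : φ (φ.symm (star (φ x))) = star (φ x) := φ.apply_symm_apply _
    have hN := isNormInvolution_of_quaternion φ hσ
    obtain ⟨e, he⟩ := hN.exists_traceForm
    exact ⟨_, e, h, Or.inr (Or.inr (Or.inl ⟨hD, a, b, c, φ, hφ, hσ⟩)), fun h => absurd h h1,
      fun h => absurd h h2, fun _ => he,
      fun _ => ne_zero_of_isQuaternionAlgebra hN ⟨a, b, c, φ, hφ⟩ he⟩
  · obtain ⟨f, hf⟩ := Module.Projective.exists_dual_ne_zero F (one_ne_zero (α := D))
    have h4 : IsHyperRadicial F D := by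
      rcases h with h | h | h | h
      exacts [absurd h h1, absurd h h2, absurd h h3, h]
    exact ⟨id, f, h, Or.inr (Or.inr (Or.inr ⟨h4, rfl⟩)), fun h => absurd h h1,
      fun h => absurd h h2, fun h => absurd h h3,
      fun _ h0 => hf (by rw [h0, LinearMap.zero_apply])⟩

end AssociatedPair
end TrivialSpectrum

namespace TrivialSpectrum

open Module LinearMap MulOpposite

/-! ### From adjoints to sesquilinear forms, and back to optimality. -/

section Sesquilinear

variable {F D V : Type*} [Field F] [DivisionRing D] [Algebra F D]
  [AddCommGroup V] [Module F V] [Module Dᵐᵒᵖ V] [IsScalarTower F Dᵐᵒᵖ V]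
  {b : LinearMap.BilinForm F V}

/-- If `alternatingEnd D b` maps every nonzero vector onto its orthogonal, then the right
multiplications by the elements of `D` have adjoints with respect to `b`, which are right
multiplications. -/
theorem exists_isNormInvolution [Nontrivial V] (hb : IsNonisotropic b)
    (h : ∀ x y : V, x ≠ 0 → b x y = 0 → ∃ u ∈ alternatingEnd D b, u x = y) :
    ∃ σ : D → D, IsNormInvolution F σ ∧ ∀ α x y, b (op α • x) y = b x (op (σ α) • y) := by
  have smul_comm' (c : F) (α : D) (x : V) : c • op α • x = op α • c • x := smul_comm _ _ _
  -- Subtracting a multiple of `x` from `y` reduces to `b x y = 0`; an alternating `u` with `u x =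
  -- y` also maps `xα` to `yα`.
  have h1 (α : D) (x y : V) (hx : x ≠ 0) :
      b (op α • x) (op α • y) = b (op α • x) (op α • x) / b x x * b x y := by
    obtain ⟨u, hu, hux⟩ := h x (y - (b x y / b x x) • x) hx (by
      rw [map_sub, map_smul, smul_eq_mul, div_mul_cancel₀ _ (hb x hx), sub_self])
    have h2 : b (op α • x) (u (op α • x)) = 0 := hu _
    rw [map_smul u, hux, smul_sub, ← smul_comm', map_sub, map_smul (b _), smul_eq_mul, sub_eq_zero] at h2
    rw [h2]
    ring
  have h2 (α : D) (x y : V) (hx : x ≠ 0) (hy : y ≠ 0) :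
      b (op α • x) (op α • x) / b x x = b (op α • y) (op α • y) / b y y := by
    by_cases hxy : ∃ c : F, y = c • x
    · obtain ⟨c, rfl⟩ := hxy
      have hc : c ≠ 0 := by rintro rfl; exact hy (zero_smul _ _)
      have hbx := hb x hx
      rw [← smul_comm']
      simp only [map_smul, LinearMap.smul_apply, smul_eq_mul]
      field_simp
    · set p := b (op α • x) (op α • x) / b x x
      set q := b (op α • y) (op α • y) / b y y
      have hs : x + y ≠ 0 := fun h0 => hxy ⟨-1, by
        rw [neg_smul, one_smul]; exact eq_neg_of_add_eq_zero_right h0⟩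
      set r := b (op α • (x + y)) (op α • (x + y)) / b (x + y) (x + y)
      -- Compare the multipliers `p`, `q`, `r` at `x`, `y`, `x + y` by additivity; nonisotropy and
      -- independence then give `p = r = q`.
      have h3 (z : V) : b ((r - p) • x + (r - q) • y) z = 0 := by
        have h4 : b (op α • (x + y)) (op α • z) = r * b (x + y) z := h1 α (x + y) z hs
        rw [smul_add, map_add, LinearMap.add_apply, h1 α x z hx, h1 α y z hy, map_add,
          LinearMap.add_apply] at h4
        simp only [map_add, map_smul, LinearMap.add_apply, LinearMap.smul_apply, smul_eq_mul]
        linear_combination -h4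
      have h5 : (r - p) • x + (r - q) • y = 0 := by
        by_contra h0
        exact hb _ h0 (h3 _)
      have h6 : r - q = 0 := by
        by_contra h0
        refine hxy ⟨-((r - q)⁻¹ * (r - p)), ?_⟩
        rw [neg_smul, mul_smul, eq_neg_of_add_eq_zero_left h5, smul_neg, neg_neg, smul_smul,
          inv_mul_cancel₀ h0, one_smul]
      rw [h6, zero_smul, add_zero, smul_eq_zero] at h5
      linear_combination h6 - h5.resolve_right hx
  obtain ⟨x₀, hx₀⟩ := exists_ne (0 : V)
  set q : D → F := fun α => b (op α • x₀) (op α • x₀) / b x₀ x₀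
  have h3 (α : D) (x y : V) : b (op α • x) (op α • y) = q α * b x y := by
    rcases eq_or_ne x 0 with rfl | hx
    · simp
    · rw [h1 α x y hx, h2 α x x₀ hx hx₀]
  -- Replace `y` by `yα⁻¹` in `h3`; the convention `0⁻¹ = 0` covers `α = 0`.
  have hadj (α : D) (x y : V) : b (op α • x) y = b x (op (q α • α⁻¹) • y) := by
    rcases eq_or_ne α 0 with rfl | hα
    · simp
    · have h4 := h3 α x (op α⁻¹ • y)
      rw [smul_smul, ← op_mul, inv_mul_cancel₀ hα, op_one, one_smul] at h4
      rw [h4, op_smul, smul_assoc, map_smul (b x), smul_eq_mul]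
  have hinj {α β : D} (hαβ : ∀ x y, b x (op α • y) = b x (op β • y)) : α = β := by
    by_contra hne
    have h4 := hαβ x₀ (op (α - β)⁻¹ • x₀)
    rw [← sub_eq_zero, ← map_sub, ← sub_smul, ← op_sub, smul_smul, ← op_mul,
      inv_mul_cancel₀ (sub_ne_zero.2 hne), op_one, one_smul] at h4
    exact hb _ hx₀ h4
  refine ⟨fun α => q α • α⁻¹, ⟨fun α β => hinj fun x y => ?_, fun c α => hinj fun x y => ?_,
    hinj fun x y => ?_, fun α β => hinj fun x y => ?_, fun α => ?_⟩, hadj⟩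
  · rw [← hadj, op_add, add_smul, map_add, LinearMap.add_apply, hadj, hadj, op_add, add_smul,
      map_add]
  · rw [← hadj, op_smul, smul_assoc, map_smul, LinearMap.smul_apply, hadj, op_smul c, smul_assoc c,
      map_smul (b x)]
  · rw [← hadj, op_one, one_smul, one_smul]
  · rw [← hadj, op_mul, mul_smul, hadj, hadj, smul_smul, ← op_mul]
  · rcases eq_or_ne α 0 with rfl | hα
    · exact ⟨0, by simp⟩
    · exact ⟨q α, by rw [smul_mul_assoc, inv_mul_cancel₀ hα]⟩

variable {σ : D → D} {e : D →ₗ[F] F}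

theorem IsSesquilinear.smul_right' {B : V → V → D} (hB : IsSesquilinear σ B) (c : F) (x y : V) :
    B x (c • y) = c • B x y := by
  rw [← algebraMap_smul Dᵐᵒᵖ c y, MulOpposite.algebraMap_apply, hB.smul_right,
    ← Algebra.commutes, Algebra.smul_def]

theorem IsTracePair.eq_of_apply_mul_eq (he : IsTracePair σ e) {v w : D}
    (h : ∀ α, e (v * α) = e (w * α)) : v = w := by
  by_contra hne
  refine he.ne_zero (LinearMap.ext fun α => ?_)
  have h1 := h ((v - w)⁻¹ * α)
  rw [← sub_eq_zero, ← map_sub, ← sub_mul, mul_inv_cancel_left₀ (sub_ne_zero.2 hne)] at h1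
  exact h1

omit [IsScalarTower F Dᵐᵒᵖ V] in
theorem IsTracePair.sesquilinear_unique (he : IsTracePair σ e) {B B' : V → V → D}
    (hB : IsSesquilinear σ B) (hb : ∀ x y, b x y = e (B x y))
    (hB' : IsSesquilinear σ B') (hb' : ∀ x y, b x y = e (B' x y)) : B = B' := by
  funext x y
  refine he.eq_of_apply_mul_eq fun α => ?_
  rw [← hB.smul_right, ← hB'.smul_right, ← hb, ← hb']

/-- The pairing `e (v * α)` is nondegenerate, so it represents the linear form α ↦ b(x, yα). The
cyclicity of `e` brings `σ α` to the left. -/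
theorem IsTracePair.exists_sesquilinear [FiniteDimensional F D] (he : IsTracePair σ e)
    (hadj : ∀ α x y, b (op α • x) y = b x (op (σ α) • y)) :
    ∃ B : V → V → D, IsSesquilinear σ B ∧ ∀ x y : V, b x y = e (B x y) := by
  let f : D →ₗ[F] Module.Dual F D := LinearMap.llcomp F D D F e ∘ₗ LinearMap.mul F D
  have hf : Function.Injective f := fun v w h =>
    he.eq_of_apply_mul_eq fun α => congrArg (fun k => k α) h
  have hsurj : Function.Surjective f :=
    (LinearMap.injective_iff_surjective_of_finrank_eq_finrank
      Subspace.dual_finrank_eq.symm).1 hf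
  have hex (x y : V) : ∃ w : D, ∀ α, b x (op α • y) = e (w * α) := by
    obtain ⟨w, hw⟩ := hsurj
      { toFun := fun α => b x (op α • y)
        map_add' := fun α β => by rw [op_add, add_smul, map_add]
        map_smul' := fun c α => by rw [op_smul, smul_assoc, map_smul]; rfl }
    exact ⟨w, fun α => (congrArg (fun k => k α) hw).symm⟩
  choose B hB using hex
  refine ⟨B, ⟨fun x x' y => ?_, fun α x y => ?_, fun x y y' => ?_, fun α x y => ?_⟩, fun x y => ?_⟩
  · refine he.eq_of_apply_mul_eq fun β => ?_
    rw [← hB, add_mul, map_add, map_add, LinearMap.add_apply, hB, hB]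
  · refine he.eq_of_apply_mul_eq fun β => ?_
    rw [← hB, hadj, smul_smul, ← op_mul, hB, ← mul_assoc, he.mul_comm, mul_assoc]
  · refine he.eq_of_apply_mul_eq fun β => ?_
    rw [← hB, add_mul, map_add, smul_add, map_add, hB, hB]
  · refine he.eq_of_apply_mul_eq fun β => ?_
    rw [← hB, smul_smul, ← op_mul, hB, mul_assoc]
  · rw [← mul_one (B x y), ← hB, op_one, one_smul]

theorem IsTracePair.le_finrank_alternatingEnd [FiniteDimensional F D] [FiniteDimensional Dᵐᵒᵖ V]
    (he : IsTracePair σ e) {B : V → V → D} (hB : IsSesquilinear σ B)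
    (hb : ∀ x y, b x y = e (B x y)) :
    finrank F D * (finrank Dᵐᵒᵖ V + 1).choose 2 ≤
      finrank F (alternatingEnd D b) + finrank Dᵐᵒᵖ V := by
  have hN := he.isNormInvolution
  have : Module.Finite F V := Module.Finite.trans Dᵐᵒᵖ V
  have := finiteDimensional_end (F := F) (R := Dᵐᵒᵖ) (V := V)
  set β := finBasis Dᵐᵒᵖ V
  let Ψ : Module.End Dᵐᵒᵖ V →ₗ[F]
      (Fin (finrank Dᵐᵒᵖ V) → F) × (∀ i : Fin (finrank Dᵐᵒᵖ V), Fin i → D) :=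
    { toFun := fun u => (fun i => e (B (β i) (u (β i))), fun i j =>
        B (β ⟨j, j.2.trans i.2⟩) (u (β i)) + σ (B (β i) (u (β ⟨j, j.2.trans i.2⟩))))
      map_add' := fun u v => by
        refine Prod.ext (funext fun i => ?_) (funext fun i => funext fun j => ?_)
        · simp [hB.add_right]
        · simp only [LinearMap.add_apply, hB.add_right, hN.map_add, Prod.snd_add, Pi.add_apply]
          abel
      map_smul' := fun c u => by
        refine Prod.ext (funext fun i => ?_) (funext fun i => funext fun j => ?_)
        · simp [hB.smul_right']
        · simp only [LinearMap.smul_apply, hB.smul_right', hN.map_smul, RingHom.id_apply,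
            Prod.smul_snd, Pi.smul_apply, smul_add] }
  have h1 := le_finrank_ker (finrank_mulOpposite F D).symm Ψ
  rw [finrank_mulOpposite] at h1
  refine h1.trans (Nat.add_le_add_right (Submodule.finrank_mono fun u hu x => ?_) _)
  have hu1 (i) : e (B (β i) (u (β i))) = 0 := congrFun (congrArg Prod.fst hu) i
  have hu2 (i j) (hj : j < i) : B (β j) (u (β i)) + σ (B (β i) (u (β j))) = 0 :=
    congrFun (congrFun (congrArg Prod.snd hu) i) ⟨j, hj⟩
  set α : Fin (finrank Dᵐᵒᵖ V) → D := fun i => unop (β.repr x i)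
  have hx : x = ∑ i, op (α i) • β i := (β.sum_repr x).symm
  set f : Fin (finrank Dᵐᵒᵖ V) → Fin (finrank Dᵐᵒᵖ V) → F :=
    fun i j => e (σ (α i) * B (β i) (u (β j)) * α j) with hf
  have hbf : b x (u x) = ∑ i, ∑ j, f i j := by
    rw [hx, map_sum, map_sum, LinearMap.sum_apply]
    refine Finset.sum_congr rfl fun i _ => ?_
    rw [map_sum]
    refine Finset.sum_congr rfl fun j _ => ?_
    rw [map_smul u, hb, hB.smul_left, hB.smul_right, ← mul_assoc]
  -- By cyclicity the norm of `α i` comes out as a scalar factor of `e (B (β i) (u (β i)))`.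
  have hdiag (i) : f i i = 0 := by
    obtain ⟨c, hc⟩ := hN.norm (α i)
    rw [hf]
    simp only
    rw [mul_assoc, he.mul_comm, mul_assoc, hN.mul_comm_self, hc, mul_smul_one, map_smul, hu1,
      smul_zero]
  have hanti (i j) (hj : j < i) : f i j + f j i = 0 := by
    rw [hf]
    simp only
    rw [eq_neg_of_add_eq_zero_left (hu2 i j hj), ← he.apply_involution (σ (α i) * _ * _), hN.map_mul,
      hN.map_mul, hN.involutive, ← map_add, mul_neg, neg_mul, ← mul_assoc, add_neg_cancel, map_zero]
  rw [hbf, ← Finset.sum_product']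
  -- Cancelling (i,j) against (j,i), with the diagonal zero by itself, avoids any division by 2.
  refine Finset.sum_involution (fun p _ => p.swap) (fun p _ => ?_) (fun p _ hp h => ?_)
    (fun p _ => by simp) (fun p _ => by simp)
  · rcases lt_trichotomy p.1 p.2 with h | h | h
    · rw [add_comm]; exact hanti _ _ h
    · obtain ⟨i, j⟩ := p
      obtain rfl : i = j := h
      simp [hdiag]
    · exact hanti _ _ h
  · obtain ⟨i, j⟩ := p
    obtain rfl : j = i := congrArg Prod.fst h
    exact hp (hdiag _)

/-- Optimality provides some adjoint involution; uniqueness of norm involutions identifies it with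
the given σ. -/
theorem IsTracePair.isIrreducible_and_isOptimal_iff [FiniteDimensional F D]
    [FiniteDimensional Dᵐᵒᵖ V] [Nontrivial V] (he : IsTracePair σ e) (hb : IsNonisotropic b)
    (hF : ((finrank Dᵐᵒᵖ V * finrank F D : ℕ) : Cardinal) ≤ Cardinal.mk F) :
    (IsIrreducible (alternatingEnd D b) ∧ IsOptimal (alternatingEnd D b)) ↔
      ∃ B : V → V → D, IsSesquilinear σ B ∧ ∀ x y : V, b x y = e (B x y) := by
  constructor
  · rintro ⟨-, hopt⟩
    obtain ⟨τ, hτ, hadj⟩ := exists_isNormInvolution hb fun x y => hopt.exists_apply_eq hb hF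
    rw [hτ.eq_of_isNormInvolution he.isNormInvolution] at hadj
    exact he.exists_sesquilinear hadj
  · rintro ⟨B, hB, hbB⟩
    have hopt := (isOptimal_alternatingEnd_iff hb hF).2 (he.le_finrank_alternatingEnd hB hbB)
    exact ⟨isIrreducible_of_exists_apply_eq hb fun x y => hopt.exists_apply_eq hb hF, hopt⟩

end Sesquilinear
end TrivialSpectrum

theorem mainTheorem4 {F D V : Type*} [Field F] [DivisionRing D] [Algebra F D]
    [FiniteDimensional F D]
    [AddCommGroup V] [Module F V] [Module Dᵐᵒᵖ V] [IsScalarTower F Dᵐᵒᵖ V]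
    [FiniteDimensional Dᵐᵒᵖ V]
    (hn : 0 < Module.finrank Dᵐᵒᵖ V)
    (hF : ((Module.finrank Dᵐᵒᵖ V * Module.finrank F D : ℕ) : Cardinal) ≤ Cardinal.mk F)
    (b : LinearMap.BilinForm F V) (hb : TrivialSpectrum.IsNonisotropic b) :
    -- the criterion, for all associated pairs
    ((TrivialSpectrum.IsIrreducible (TrivialSpectrum.alternatingEnd D b) ∧
        TrivialSpectrum.IsOptimal (TrivialSpectrum.alternatingEnd D b)) ↔
      (TrivialSpectrum.IsQuadraticType F D ∧
        ∀ (σ : D → D) (e : D →ₗ[F] F), TrivialSpectrum.IsAssociatedPair F D σ e →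
          ∃ B : V → V → D, TrivialSpectrum.IsSesquilinear σ B ∧ ∀ x y : V, b x y = e (B x y))) ∧
    -- the criterion, for any fixed associated pair
    (∀ (σ : D → D) (e : D →ₗ[F] F), TrivialSpectrum.IsAssociatedPair F D σ e →
      ((TrivialSpectrum.IsIrreducible (TrivialSpectrum.alternatingEnd D b) ∧
          TrivialSpectrum.IsOptimal (TrivialSpectrum.alternatingEnd D b)) ↔
        ∃ B : V → V → D, TrivialSpectrum.IsSesquilinear σ B ∧ ∀ x y : V, b x y = e (B x y))) ∧
    -- uniqueness of the sesquilinear form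
    (∀ (σ : D → D) (e : D →ₗ[F] F), TrivialSpectrum.IsAssociatedPair F D σ e →
      ∀ B B' : V → V → D,
        TrivialSpectrum.IsSesquilinear σ B → (∀ x y : V, b x y = e (B x y)) →
        TrivialSpectrum.IsSesquilinear σ B' → (∀ x y : V, b x y = e (B' x y)) → B = B') := by
  open TrivialSpectrum in
  have : Nontrivial V := Module.nontrivial_of_finrank_pos hn
  refine ⟨⟨fun h => ⟨?_, fun σ e he => ?_⟩, fun h => ?_⟩, fun σ e he => ?_,
    fun σ e he B B' hB hbB hB' hbB' => he.isTracePair.sesquilinear_unique hB hbB hB' hbB'⟩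
  · obtain ⟨σ, hσ, -⟩ := exists_isNormInvolution hb fun x y => h.2.exists_apply_eq hb hF
    exact hσ.isQuadraticType
  · exact (he.isTracePair.isIrreducible_and_isOptimal_iff hb hF).1 h
  · obtain ⟨σ, e, he⟩ := exists_isAssociatedPair h.1
    exact (he.isTracePair.isIrreducible_and_isOptimal_iff hb hF).2 (h.2 σ e he)
  · exact he.isTracePair.isIrreducible_and_isOptimal_iff hb hF
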